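/- Logarithms are to base $2$ and mutual information $I(\cdot\,;\cdot)$ is in bits. A classical protocol $\Pi$ in the simultaneous message passing (SMP) model, with inputs $x\in X$ for Alice and $y\in Y$ for Bob ($X$, $Y$ finite) and output in $Z$, consists of finite message sets $M_A,M_B$; independent random strings $R_A,R_B,R_C$ (private to Alice, Bob and the referee), $R_{AC}$ (shared by Alice and the referee) and $R_{BC}$ (shared by Bob and the referee), with arbitrary probability distributions; and maps $\Pi_A(x,r_A,r_{AC})\in M_A$, $\Pi_B(y,r_B,r_{BC})\in M_B$, $\Pi_C(m_A,m_B,r_C,r_{AC},r_{BC})\in Z$. Alice and Bob share no randomness. The output $\Pi(x,y)$ is the value of $\Pi_C$ on the two messages and the referee's random strings. The protocol computes $f:X\times Y\to Z$ with error $\epsilon$ if $\Pr[\Pi(x,y)\ne f(x,y)]\le\epsilon$ for every $(x,y)$. Its information leakage is $$IL(\Pi)=\sup_{\mu} I(XY;\,M_AM_BR_CR_{AC}R_{BC}),$$ where $\mu$ ranges over all probability distributions on $X\times Y$, the input $(X,Y)$ is drawn from $\mu$ independently of the random strings, and $M_A,M_B$ are the resulting messages. The information leakage for computing $f$ with error $\epsilon$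 is $IL(f,\epsilon)=\inf_\Pi IL(\Pi)$ over all protocols $\Pi$ that compute $f$ with error $\epsilon$. Let $EQ_n:\{0,1\}^n\times\{0,1\}^n\to\{0,1\}$ be the equality function, $EQ_n(x,y)=1$ if and only if $x=y$, and let $$g_1(x)=2\log(x+1)+10,\qquad g_2(x,y,z)=2\log\Big(\frac{2(x+y)}{z^2\log e}+1\Big)+2,\qquad g_3(x)=2\Big(\frac12-x\Big)^2\log e .$$ Theorem. For every natural number $n$, every $\epsilon\ge0$ and all $\delta_1,\delta_2>0$ with $\epsilon+\delta_1+\delta_2<\frac12$, the quantity $IL(EQ_n,\epsilon)$ is finite and $$IL(EQ_n,\epsilon)\ \ge\ \delta_1\Big(2\sqrt{g_3(\epsilon+\delta_1+\delta_2)}\,\sqrt n-g_3(\epsilon+\delta_1+\delta_2)-g_2(n,n,\delta_2)-10\Big)-2g_1(2n).$$ -/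

import Mathlib

open MeasureTheory
open scoped ENNReal

universe u

noncomputable section

namespace SMP

/-- Mutual information `I(U; V)`, in bits, of two random variables on a probability space: the
relative entropy of the joint law with respect to the product of the marginal laws
(`klDiv` uses natural logarithms, hence the factor `log 2`). -/
def mutualInfo {Ω S T : Type*} [MeasurableSpace Ω] [MeasurableSpace S] [MeasurableSpace T]
    (ρ : Measure Ω) (U : Ω → S) (V : Ω → T) : ℝ≥0∞ :=
  InformationTheory.klDiv (ρ.map fun ω => (U ω, V ω)) ((ρ.map U).prod (ρ.map V)) /
    ENNReal.ofReal (Real.log 2)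

/-- A protocol in the shared randomness simultaneous message passing model: finite message sets,
probability spaces for the private randomness of Alice (`RA`), of Bob (`RB`) and of the
referee (`RC`) and for the randomness that Alice (`RAC`) and Bob (`RBC`) each share with the
referee, and the three (measurable) maps of the players. -/
structure Protocol (X Y Z : Type) [MeasurableSpace X] [MeasurableSpace Y]
    [MeasurableSpace Z] where
  MA : Type u
  MB : Type u
  RA : Type u
  RB : Type u
  RC : Type u
  RAC : Type u
  RBC : Type u
  [finiteMA : Finite MA]
  [finiteMB : Finite MB]
  [measurableMA : MeasurableSpace MA]
  [measurableMB : MeasurableSpace MB]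
  [discreteMA : DiscreteMeasurableSpace MA]
  [discreteMB : DiscreteMeasurableSpace MB]
  [measurableRA : MeasurableSpace RA]
  [measurableRB : MeasurableSpace RB]
  [measurableRC : MeasurableSpace RC]
  [measurableRAC : MeasurableSpace RAC]
  [measurableRBC : MeasurableSpace RBC]
  lawRA : Measure RA
  lawRB : Measure RB
  lawRC : Measure RC
  lawRAC : Measure RAC
  lawRBC : Measure RBC
  [probRA : IsProbabilityMeasure lawRA]
  [probRB : IsProbabilityMeasure lawRB]
  [probRC : IsProbabilityMeasure lawRC]
  [probRAC : IsProbabilityMeasure lawRAC]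
  [probRBC : IsProbabilityMeasure lawRBC]
  /-- Alice's message. -/
  alice : X × RA × RAC → MA
  /-- Bob's message. -/
  bob : Y × RB × RBC → MB
  /-- The referee's output. -/
  referee : MA × MB × RC × RAC × RBC → Z
  measurable_alice : Measurable alice
  measurable_bob : Measurable bob
  measurable_referee : Measurable referee

attribute [instance] Protocol.finiteMA Protocol.finiteMB Protocol.measurableMA
  Protocol.measurableMB Protocol.discreteMA Protocol.discreteMB Protocol.measurableRA
  Protocol.measurableRB Protocol.measurableRC Protocol.measurableRAC Protocol.measurableRBC
  Protocol.probRA Protocol.probRB Protocol.probRC Protocol.probRAC Protocol.probRBC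

namespace Protocol

variable {X Y Z : Type} [MeasurableSpace X] [MeasurableSpace Y] [MeasurableSpace Z]

/-- All the randomness `(r_A, r_B, r_C, r_AC, r_BC)` of one run. -/
abbrev Rand (P : Protocol.{u} X Y Z) : Type u := P.RA × P.RB × P.RC × P.RAC × P.RBC

/-- The five sources of randomness are independent. -/
def randLaw (P : Protocol.{u} X Y Z) : Measure P.Rand :=
  P.lawRA.prod (P.lawRB.prod (P.lawRC.prod (P.lawRAC.prod P.lawRBC)))

/-- Everything that the referee holds at the end of a run on input `(x, y)` with randomness `r`:
both messages, its private randomness and both shared random strings. -/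
def refereeView (P : Protocol.{u} X Y Z) (xy : X × Y) (r : P.Rand) :
    P.MA × P.MB × P.RC × P.RAC × P.RBC :=
  let (rA, rB, rC, rAC, rBC) := r
  (P.alice (xy.1, rA, rAC), P.bob (xy.2, rB, rBC), rC, rAC, rBC)

/-- The output of a run on input `(x, y)` with randomness `r`. -/
def output (P : Protocol.{u} X Y Z) (xy : X × Y) (r : P.Rand) : Z :=
  P.referee (P.refereeView xy r)

/-- The probability of error for the function `f` on input `(x, y)`. -/
def errorProb (P : Protocol.{u} X Y Z) (f : X × Y → Z) (xy : X × Y) : ℝ :=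
  P.randLaw.real {r | P.output xy r ≠ f xy}

/-- The protocol computes `f` with worst-case error at most `ε`. -/
def Computes (P : Protocol.{u} X Y Z) (f : X × Y → Z) (ε : ℝ) : Prop :=
  ∀ xy : X × Y, P.errorProb f xy ≤ ε

/-- Information leakage `I(XY; M_A M_B R_C R_AC R_BC)` of the protocol when the inputs are
drawn from `μ`, independently of the randomness. -/
def leakageOn (P : Protocol.{u} X Y Z) (μ : Measure (X × Y)) : ℝ≥0∞ :=
  mutualInfo (μ.prod P.randLaw) (fun ω => ω.1) (fun ω => P.refereeView ω.1 ω.2)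

/-- Information leakage of the protocol: worst case over all input distributions. -/
def leakage (P : Protocol.{u} X Y Z) : ℝ≥0∞ :=
  ⨆ (μ : Measure (X × Y)) (_ : IsProbabilityMeasure μ), P.leakageOn μ

end Protocol

/-- Information leakage `IL(f, ε)` for computing `f` with error `ε`. -/
def IL {X Y Z : Type} [MeasurableSpace X] [MeasurableSpace Y] [MeasurableSpace Z]
    (f : X × Y → Z) (ε : ℝ) : ℝ≥0∞ :=
  ⨅ (P : Protocol.{u} X Y Z) (_ : P.Computes f ε), P.leakage

/-- The equality function on `n`-bit strings. -/
def EQ (n : ℕ) (xy : (Fin n → Bool) × (Fin n → Bool)) : Bool := decide (xy.1 = xy.2)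

/-- Base two logarithm of `e`. -/
def log2e : ℝ := Real.logb 2 (Real.exp 1)

def g₁ (x : ℝ) : ℝ := 2 * Real.logb 2 (x + 1) + 10

def g₂ (x y z : ℝ) : ℝ := 2 * Real.logb 2 (2 * (x + y) / (z ^ 2 * log2e) + 1) + 2

def g₃ (x : ℝ) : ℝ := 2 * (1 / 2 - x) ^ 2 * log2e

end SMP

end

/-! Let the inputs be independent and uniform on a set of `N` elements. Alice's view (her message
and the string shared with the referee) has law `A x`, Bob's has law `B y`. Averaging over the
referee's private randomness leaves a function `F` into `[0, 1]`, with mean at least `1 - ε` under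
`A x × B y` if `x = y` and at most `ε` otherwise. Given the inputs the two views are independent, so
the leakage is at least `a + b` nats, where `a` and `b` are the average relative entropies of the `A
x` and the `B y` to their uniform mixtures (`klDiv_le_leakage`, `ofReal_add_le_klDiv`).

The heart is a trade-off between `a` and `b` (`log_card_le`). Take `t` independent samples from `A
x`. By Hoeffding's inequality, their empirical mean of `F (·, z)` is accurate up to `τ` for all `z`
outside a set whose mass under Bob's mixture is typically exponentially small in `t`. For at least
half of the `y`, the density of `B y` is at most `exp l` outside mass `d`, with `l = 2 (b + 1) / d`.
Once `t` is of order `l / τ ^ 2` (plus a logarithmic term), the bad set is therefore small under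
these `B y` as well. The samples then predict the acceptance probability against each such `y` to
within `1/2 - ε`, and a threshold at `1/2` recovers `x`. As in Fano's inequality, recovering `x`
from `t` samples forces `31/64 * log N ≤ t * a + 1`.

Put `σ = 1/2 - ε`. Choosing `t` of order `(b + 1) / σ ^ 3` makes `a * (b + 2)` at least of order `σ
^ 3 * log N`, up to an additive constant, and the inequality between arithmetic and geometric mean
gives `a + b ≥ σ ^ 2 * √(log N / 2) - 3` (`sq_mul_sqrt_le_of_tradeoff`). This implies the stated
bound, whose correction terms are then mere slack (`eq_lower_bound_le`). Finiteness is witnessed by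
the protocol that sends both inputs. -/

noncomputable section

namespace SMP

/-! ### Relative entropy inequalities for explicit densities. -/

section Gibbs

variable {Ω : Type*} [MeasurableSpace Ω]

/-- Only an inequality, since the density and its inverse multiply to `0` rather than `1` where `r ≤
0`. -/
lemma lintegral_mul_inv_density_le (ν : Measure Ω) {r : Ω → ℝ} (hr : Measurable r)
    {v : Ω → ℝ≥0∞} (hv : Measurable v) :
    ∫⁻ ω, v ω * (ENNReal.ofReal (r ω))⁻¹ ∂(ν.withDensity fun ω => ENNReal.ofReal (r ω))
      ≤ ∫⁻ ω, v ω ∂ν := by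
  rw [lintegral_withDensity_eq_lintegral_mul _ (by fun_prop) (by fun_prop)]
  refine lintegral_mono fun ω => ?_
  calc ENNReal.ofReal (r ω) * (v ω * (ENNReal.ofReal (r ω))⁻¹)
      = v ω * (ENNReal.ofReal (r ω) * (ENNReal.ofReal (r ω))⁻¹) := by ring
    _ ≤ v ω * 1 := by gcongr; exact ENNReal.mul_inv_le_one _
    _ = v ω := mul_one _

lemma ae_density_pos {P ν : Measure Ω} {r : Ω → ℝ} (hr : Measurable r)
    (hP : P = ν.withDensity fun ω => ENNReal.ofReal (r ω)) : ∀ᵐ ω ∂P, 0 < r ω := by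
  rw [hP, ae_withDensity_iff (by fun_prop)]
  exact Filter.Eventually.of_forall fun ω h => by simpa using h

/-- Gibbs' variational inequality in linear form. -/
lemma integral_log_le_of_density {P ν : Measure Ω} [IsProbabilityMeasure P] {r u : Ω → ℝ} {c : ℝ}
    (hr : Measurable r) (hP : P = ν.withDensity fun ω => ENNReal.ofReal (r ω))
    (hlr : Integrable (fun ω => Real.log (r ω)) P) (hu : Measurable u)
    (hpos : ∀ᵐ ω ∂P, 0 < u ω) (hlu : Integrable (fun ω => Real.log (u ω)) P) (hc : 0 ≤ c)
    (huR : ∫⁻ ω, ENNReal.ofReal (u ω) ∂ν ≤ ENNReal.ofReal c) :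
    ∫ ω, Real.log (u ω) ∂P ≤ ∫ ω, Real.log (r ω) ∂P + c - 1 := by
  have hrpos := ae_density_pos hr hP
  have hle : ∫⁻ ω, ENNReal.ofReal (u ω / r ω) ∂P ≤ ENNReal.ofReal c := by
    calc ∫⁻ ω, ENNReal.ofReal (u ω / r ω) ∂P
        = ∫⁻ ω, ENNReal.ofReal (u ω) * (ENNReal.ofReal (r ω))⁻¹ ∂P := by
          refine lintegral_congr_ae ?_
          filter_upwards [hrpos] with ω h
          rw [ENNReal.ofReal_div_of_pos h, div_eq_mul_inv]
      _ ≤ ∫⁻ ω, ENNReal.ofReal (u ω) ∂ν := by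
          rw [hP]
          exact lintegral_mul_inv_density_le ν hr (by fun_prop)
      _ ≤ _ := huR
  have hnn : 0 ≤ᵐ[P] fun ω => u ω / r ω := by
    filter_upwards [hrpos, hpos] with ω h1 h2 using (div_pos h2 h1).le
  have hint : Integrable (fun ω => u ω / r ω) P := by
    refine (lintegral_ofReal_ne_top_iff_integrable
      (hu.div hr).aestronglyMeasurable hnn).mp (ne_top_of_le_ne_top ENNReal.ofReal_ne_top hle)
  have hval : ∫ ω, u ω / r ω ∂P ≤ c := by
    rw [integral_eq_lintegral_of_nonneg_ae hnn hint.aestronglyMeasurable]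
    exact ENNReal.toReal_le_of_le_ofReal hc hle
  have hmono : ∫ ω, (Real.log (u ω) - Real.log (r ω)) ∂P ≤ ∫ ω, (u ω / r ω - 1) ∂P := by
    refine integral_mono_ae (hlu.sub hlr) (hint.sub (integrable_const 1)) ?_
    filter_upwards [hrpos, hpos] with ω h1 h2
    rw [← Real.log_div h2.ne' h1.ne']
    exact Real.log_le_sub_one_of_pos (div_pos h2 h1)
  rw [integral_sub hlu hlr, integral_sub hint (integrable_const 1)] at hmono
  simp only [integral_const, probReal_univ, smul_eq_mul, mul_one] at hmono
  linarith

/-- An event of small `ν`-probability can only have large `P`-probability at the expense of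
relative entropy. -/
lemma mul_measureReal_le_of_density {P ν : Measure Ω} [IsProbabilityMeasure P]
    [IsProbabilityMeasure ν] {r : Ω → ℝ}
    (hr : Measurable r) (hP : P = ν.withDensity fun ω => ENNReal.ofReal (r ω))
    (hlr : Integrable (fun ω => Real.log (r ω)) P) {G : Set Ω} (hG : MeasurableSet G)
    {l : ℝ} (hl : 0 ≤ l) :
    l * P.real G ≤ ∫ ω, Real.log (r ω) ∂P + (Real.exp l - 1) * ν.real G := by
  classical
  have he : 0 ≤ Real.exp l - 1 := by linarith [Real.one_le_exp hl]
  -- The test function is `exp l` on `G` and `1` elsewhere, so that its logarithm is `l` times the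
  -- indicator of `G`.
  let u : Ω → ℝ := fun ω => 1 + G.indicator (fun _ => Real.exp l - 1) ω
  have hu : Measurable u := measurable_const.add (measurable_const.indicator hG)
  have hpos : ∀ ω, 0 < u ω := fun ω => by
    have : 0 ≤ G.indicator (fun _ => Real.exp l - 1) ω := Set.indicator_nonneg (fun _ _ => he) ω
    simp only [u]; linarith
  have hlog : (fun ω => Real.log (u ω)) = G.indicator fun _ => l := by
    ext ω
    by_cases h : ω ∈ G <;> simp [u, h]
  have hlu : Integrable (fun ω => Real.log (u ω)) P := by
    rw [hlog]; exact (integrable_const l).indicator hG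
  have hint : Integrable u ν := (integrable_const 1).add ((integrable_const _).indicator hG)
  have hval : ∫ ω, u ω ∂ν = 1 + (Real.exp l - 1) * ν.real G := by
    simp only [u]
    rw [integral_add (integrable_const 1) ((integrable_const _).indicator hG),
      integral_indicator_const _ hG]
    simp [mul_comm]
  have := integral_log_le_of_density (c := 1 + (Real.exp l - 1) * ν.real G) hr hP hlr hu
    (Filter.Eventually.of_forall hpos) hlu (by positivity)
    (by rw [← hval, ofReal_integral_eq_lintegral_ofReal hint
          (Filter.Eventually.of_forall fun ω => (hpos ω).le)])
  rw [hlog, integral_indicator_const _ hG, smul_eq_mul] at this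
  linarith

/-- The positive part of `log r` is controlled by `C`, the negative part by `log (1 / r) ≤ 1 / r -
1`; and `1 / r` has `P`-integral at most the total mass of `ν`. -/
lemma integrable_log_density {P ν : Measure Ω} [IsProbabilityMeasure P]
    [IsProbabilityMeasure ν] {r : Ω → ℝ} {C : ℝ}
    (hr : Measurable r) (hP : P = ν.withDensity fun ω => ENNReal.ofReal (r ω))
    (hC : ∀ᵐ ω ∂P, r ω ≤ C) : Integrable (fun ω => Real.log (r ω)) P := by
  have hrpos := ae_density_pos hr hP
  have hint : Integrable (fun ω => (r ω)⁻¹) P := by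
    refine (lintegral_ofReal_ne_top_iff_integrable hr.inv.aestronglyMeasurable ?_).mp ?_
    · filter_upwards [hrpos] with ω h using (inv_pos.mpr h).le
    · refine ne_top_of_le_ne_top ENNReal.one_ne_top ?_
      calc ∫⁻ ω, ENNReal.ofReal (r ω)⁻¹ ∂P
          = ∫⁻ ω, 1 * (ENNReal.ofReal (r ω))⁻¹ ∂P := by
            refine lintegral_congr_ae ?_
            filter_upwards [hrpos] with ω h
            rw [ENNReal.ofReal_inv_of_pos h, one_mul]
        _ ≤ ∫⁻ _, 1 ∂ν := by
            rw [hP]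
            exact lintegral_mul_inv_density_le ν hr measurable_const
        _ = 1 := by simp
  refine ((integrable_const (|Real.log C|)).add hint).mono'
    (Real.measurable_log.comp hr).aestronglyMeasurable ?_
  filter_upwards [hrpos, hC] with ω h1 h2
  have h3 : Real.log (r ω) ≤ Real.log C := Real.log_le_log h1 h2
  have h4 : Real.log (r ω)⁻¹ ≤ (r ω)⁻¹ - 1 := Real.log_le_sub_one_of_pos (inv_pos.mpr h1)
  rw [Real.log_inv] at h4
  have h5 := le_abs_self (Real.log C)
  have h6 : 0 < (r ω)⁻¹ := inv_pos.mpr h1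
  have h7 := abs_nonneg (Real.log C)
  rw [Real.norm_eq_abs, abs_le]
  simp only [Pi.add_apply]
  constructor <;> linarith

/-- On boxes the integrand factors over the coordinates, which are independent under the product
measure. -/
lemma pi_withDensity {ι : Type*} [Fintype ι] (μ : Measure Ω) [IsProbabilityMeasure μ]
    {f : Ω → ℝ≥0∞} (hf : Measurable f) [SigmaFinite (μ.withDensity f)] :
    Measure.pi (fun _ : ι => μ.withDensity f) =
      (Measure.pi fun _ : ι => μ).withDensity fun x => ∏ i, f (x i) := by
  refine Measure.pi_eq fun s hs => ?_
  rw [withDensity_apply _ (MeasurableSet.univ_pi hs),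
    ← lintegral_indicator (MeasurableSet.univ_pi hs)]
  have h1 : ∀ x : ι → Ω, (Set.univ.pi s).indicator (fun x => ∏ i, f (x i)) x
      = ∏ i, (s i).indicator f (x i) := fun x => by
    classical
    by_cases hx : x ∈ Set.univ.pi s
    · rw [Set.indicator_of_mem hx]
      refine Finset.prod_congr rfl fun i _ => ?_
      rw [Set.indicator_of_mem (hx i (Set.mem_univ i))]
    · rw [Set.indicator_of_notMem hx]
      simp only [Set.mem_univ_pi, not_forall] at hx
      obtain ⟨i, hi⟩ := hx
      exact (Finset.prod_eq_zero (Finset.mem_univ i) (Set.indicator_of_notMem hi f)).symm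
  simp_rw [h1]
  have hm : ∀ i, Measurable ((s i).indicator f) := fun i => hf.indicator (hs i)
  rw [ProbabilityTheory.lintegral_prod_eq_prod_lintegral_of_indepFun Finset.univ
    (fun i (x : ι → Ω) => (s i).indicator f (x i))
    (ProbabilityTheory.iIndepFun_pi fun i => (hm i).aemeasurable)
    (fun i => (hm i).comp (measurable_pi_apply i))]
  refine Finset.prod_congr rfl fun i _ => ?_
  rw [(measurePreserving_eval (fun _ : ι => μ) i).lintegral_comp (hm i),
    lintegral_indicator (hs i), withDensity_apply _ (hs i)]

end Gibbs

/-! ### Empirical means and change of measure. -/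

section Sampling

variable {S T : Type*}

/-- The empirical mean of `φ` over the sample `s`. -/
def empMean {t : ℕ} (φ : S → ℝ) (s : Fin t → S) : ℝ := (∑ i, φ (s i)) / t

lemma empMean_mem_Icc {t : ℕ} {φ : S → ℝ} (hφ : ∀ s, φ s ∈ Set.Icc (0 : ℝ) 1) (s : Fin t → S) :
    empMean φ s ∈ Set.Icc (0 : ℝ) 1 := by
  refine ⟨div_nonneg (Finset.sum_nonneg fun i _ => (hφ _).1) t.cast_nonneg,
    div_le_one_of_le₀ ?_ t.cast_nonneg⟩
  calc ∑ i, φ (s i) ≤ ∑ _i : Fin t, (1 : ℝ) := Finset.sum_le_sum fun i _ => (hφ _).2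
    _ = t := by simp

variable [MeasurableSpace S] [MeasurableSpace T]

/-- Hoeffding's upper tail. The interval is kept general, of length one, to cover both `φ` and `-φ`.
-/
lemma measureReal_le_sum_pi (P : Measure S) [IsProbabilityMeasure P] {φ : S → ℝ}
    (hφ : Measurable φ) {a b : ℝ} (hab : b - a = 1) (hI : ∀ s, φ s ∈ Set.Icc a b)
    {t : ℕ} (ht : 0 < t) {τ : ℝ} (hτ : 0 ≤ τ) :
    (Measure.pi fun _ : Fin t => P).real {s | τ * t ≤ ∑ i, (φ (s i) - ∫ x, φ x ∂P)}
      ≤ Real.exp (-(2 * τ ^ 2 * t)) := by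
  have hmg : ∀ i : Fin t, ProbabilityTheory.HasSubgaussianMGF
      (fun s : Fin t → S => φ (s i) - ∫ x, φ x ∂P) ((‖b - a‖₊ / 2) ^ 2)
      (Measure.pi fun _ : Fin t => P) := fun i => by
    have h := ProbabilityTheory.hasSubgaussianMGF_of_mem_Icc (μ := P) (X := φ) (a := a) (b := b)
      hφ.aemeasurable (Filter.Eventually.of_forall hI)
    have hmp := measurePreserving_eval (fun _ : Fin t => P) i
    rw [← hmp.map_eq] at h
    have h' := h.of_map hmp.measurable.aemeasurable
    rw [hmp.map_eq] at h'
    exact h'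
  have hind : ProbabilityTheory.iIndepFun (fun (i : Fin t) (s : Fin t → S) =>
      φ (s i) - ∫ x, φ x ∂P) (Measure.pi fun _ : Fin t => P) :=
    ProbabilityTheory.iIndepFun_pi (X := fun _ s => φ s - ∫ x, φ x ∂P)
      fun i => (hφ.sub_const _).aemeasurable
  have ht' : (0 : ℝ) < t := by exact_mod_cast ht
  refine (ProbabilityTheory.HasSubgaussianMGF.measure_sum_ge_le_of_iIndepFun hind
    (s := Finset.univ) (fun i _ => hmg i) (by positivity : 0 ≤ τ * t)).trans (le_of_eq ?_)
  rw [hab]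
  simp
  field_simp

/-- Two-sided Hoeffding bound for empirical means of functions with values in `[0, 1]`. -/
lemma measureReal_empMean_deviation_le (P : Measure S) [IsProbabilityMeasure P] {φ : S → ℝ}
    (hφ : Measurable φ) (hb : ∀ s, φ s ∈ Set.Icc (0 : ℝ) 1) {t : ℕ} (ht : 0 < t) {τ : ℝ}
    (hτ : 0 ≤ τ) :
    (Measure.pi fun _ : Fin t => P).real {s | τ ≤ |empMean φ s - ∫ x, φ x ∂P|}
      ≤ 2 * Real.exp (-(2 * τ ^ 2 * t)) := by
  have ht' : (0 : ℝ) < t := by exact_mod_cast ht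
  have h1 := measureReal_le_sum_pi P hφ (a := 0) (b := 1) (by norm_num) hb ht hτ
  have h2 := measureReal_le_sum_pi P hφ.neg (a := -1) (b := 0) (by norm_num)
    (fun s => by simpa [and_comm] using hb s) ht hτ
  calc _ ≤ (Measure.pi fun _ : Fin t => P).real
        ({s | τ * t ≤ ∑ i, (φ (s i) - ∫ x, φ x ∂P)} ∪
          {s | τ * t ≤ ∑ i, ((-φ) (s i) - ∫ x, (-φ) x ∂P)}) := by
        refine measureReal_mono ?_
        intro s hs
        have e : ∑ i, (φ (s i) - ∫ x, φ x ∂P) = (empMean φ s - ∫ x, φ x ∂P) * t := by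
          simp only [empMean, Finset.sum_sub_distrib, Finset.sum_const, Finset.card_univ,
            Fintype.card_fin, nsmul_eq_mul]
          field_simp
        have e' : ∑ i, ((-φ) (s i) - ∫ x, (-φ) x ∂P) = -(empMean φ s - ∫ x, φ x ∂P) * t := by
          simp only [Pi.neg_apply, integral_neg, empMean, Finset.sum_sub_distrib,
            Finset.sum_const, Finset.card_univ, Finset.sum_neg_distrib,
            Fintype.card_fin, nsmul_eq_mul]
          field_simp
          ring
        simp only [Set.mem_union, Set.mem_ofPred_eq, e, e']
        rcases le_abs.mp (show τ ≤ |empMean φ s - ∫ x, φ x ∂P| from hs) with h | h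
        · left; gcongr
        · right; gcongr
    _ ≤ _ := measureReal_union_le _ _
    _ ≤ _ := by linarith

/-- The arguments `y` at which the empirical mean of `F (·, y)` is `τ`-far from its expectation. -/
def badSet (P : Measure S) (F : S × T → ℝ) (τ : ℝ) {t : ℕ} (s : Fin t → S) : Set T :=
  {y | τ ≤ |empMean (fun x => F (x, y)) s - ∫ x, F (x, y) ∂P|}

lemma measurableSet_prod_badSet (P : Measure S) [IsProbabilityMeasure P] {F : S × T → ℝ}
    (hF : Measurable F) (τ : ℝ) (t : ℕ) :
    MeasurableSet {p : (Fin t → S) × T | p.2 ∈ badSet P F τ p.1} := by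
  have h1 : Measurable fun p : (Fin t → S) × T => empMean (fun x => F (x, p.2)) p.1 := by
    unfold empMean
    refine Measurable.div_const (Finset.measurable_sum _ fun i _ => ?_) _
    exact hF.comp (by fun_prop)
  have h2 : Measurable fun y : T => ∫ x, F (x, y) ∂P :=
    hF.stronglyMeasurable.integral_prod_left'.measurable
  exact measurableSet_le measurable_const
    ((h1.sub (h2.comp measurable_snd)).abs)

/-- Hoeffding's inequality holds for each fixed `y`; Fubini turns it into a bound on the expected
`Q`-mass of the bad set, and Markov's inequality finishes. -/
lemma measureReal_badSet_ge_le (P : Measure S) [IsProbabilityMeasure P] (Q : Measure T)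
    [IsProbabilityMeasure Q] {F : S × T → ℝ} (hF : Measurable F)
    (hb : ∀ p, F p ∈ Set.Icc (0 : ℝ) 1) {t : ℕ} (ht : 0 < t) {τ θ : ℝ} (hτ : 0 ≤ τ)
    (hθ : 0 < θ) :
    (Measure.pi fun _ : Fin t => P).real {s | θ ≤ Q.real (badSet P F τ s)}
      ≤ 2 * Real.exp (-(2 * τ ^ 2 * t)) / θ := by
  have hM := measurableSet_prod_badSet P hF τ t
  have hfib : ∫⁻ s, Q (badSet P F τ s) ∂(Measure.pi fun _ : Fin t => P)
      ≤ ENNReal.ofReal (2 * Real.exp (-(2 * τ ^ 2 * t))) := by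
    calc ∫⁻ s, Q (badSet P F τ s) ∂(Measure.pi fun _ : Fin t => P)
        = ((Measure.pi fun _ : Fin t => P).prod Q) {p | p.2 ∈ badSet P F τ p.1} := by
          rw [Measure.prod_apply hM]; rfl
      _ = ∫⁻ y, (Measure.pi fun _ : Fin t => P)
            {s | τ ≤ |empMean (fun x => F (x, y)) s - ∫ x, F (x, y) ∂P|} ∂Q := by
          rw [Measure.prod_apply_symm hM]; rfl
      _ ≤ ∫⁻ _, ENNReal.ofReal (2 * Real.exp (-(2 * τ ^ 2 * t))) ∂Q := by
          refine lintegral_mono fun y => ?_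
          rw [← ofReal_measureReal]
          exact ENNReal.ofReal_le_ofReal (measureReal_empMean_deviation_le P
            (hF.comp (by fun_prop : Measurable fun x : S => (x, y))) (fun s => hb _) ht hτ)
      _ = _ := by simp
  have hmk := mul_meas_ge_le_lintegral (μ := Measure.pi fun _ : Fin t => P)
    (measurable_measure_prodMk_left hM : Measurable fun s => Q (badSet P F τ s))
    (ENNReal.ofReal θ)
  have hset : {s : Fin t → S | θ ≤ Q.real (badSet P F τ s)} =
      {s | ENNReal.ofReal θ ≤ Q (badSet P F τ s)} := by
    ext s
    simp only [Set.mem_ofPred_eq]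
    rw [ENNReal.ofReal_le_iff_le_toReal (measure_ne_top _ _)]
    rfl
  rw [le_div_iff₀ hθ, hset, mul_comm]
  have := ENNReal.toReal_mono ENNReal.ofReal_ne_top (hmk.trans hfib)
  rwa [ENNReal.toReal_mul, ENNReal.toReal_ofReal hθ.le, ENNReal.toReal_ofReal (by positivity)]
    at this

/-- Where `r ≤ c`, passing from `ν` to `P` inflates mass by at most `c`. This transfers smallness of
the bad set from the mixture to the law of a single message of Bob. -/
lemma measureReal_le_of_density {P ν : Measure T} [IsProbabilityMeasure P]
    [IsProbabilityMeasure ν] {r : T → ℝ}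
    (hr : Measurable r) (hP : P = ν.withDensity fun ω => ENNReal.ofReal (r ω))
    {E : Set T} (hE : MeasurableSet E) (c : ℝ) (hc : 0 ≤ c) :
    P.real E ≤ P.real {y | c < r y} + c * ν.real E := by
  have hm : MeasurableSet {y | c < r y} := measurableSet_lt measurable_const hr
  have h1 : P (E \ {y | c < r y}) ≤ ENNReal.ofReal c * ν E := by
    rw [hP, withDensity_apply _ (hE.diff hm)]
    calc _ ≤ ∫⁻ _ in E \ {y | c < r y}, ENNReal.ofReal c ∂ν := by
          refine setLIntegral_mono measurable_const fun y hy => ?_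
          exact ENNReal.ofReal_le_ofReal (not_lt.mp hy.2)
      _ = ENNReal.ofReal c * ν (E \ {y | c < r y}) := by simp
      _ ≤ _ := by gcongr; exact Set.sdiff_subset
  have h2 : P.real (E \ {y | c < r y}) ≤ c * ν.real E := by
    have := ENNReal.toReal_mono (by finiteness) h1
    rwa [ENNReal.toReal_mul, ENNReal.toReal_ofReal hc] at this
  calc P.real E ≤ P.real ({y | c < r y} ∪ E \ {y | c < r y}) :=
        measureReal_mono (by intro y hy; by_cases h : c < r y <;> simp [h, hy])
    _ ≤ _ := measureReal_union_le _ _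
    _ ≤ _ := by linarith

lemma mul_measureReal_lt_density_le_one {P ν : Measure T} [IsProbabilityMeasure P]
    [IsProbabilityMeasure ν] {r : T → ℝ}
    (hr : Measurable r) (hP : P = ν.withDensity fun ω => ENNReal.ofReal (r ω)) (c : ℝ)
    (hc : 0 ≤ c) : c * ν.real {y | c < r y} ≤ 1 := by
  have hm : MeasurableSet {y | c < r y} := measurableSet_lt measurable_const hr
  have h1 : ENNReal.ofReal c * ν {y | c < r y} ≤ P {y | c < r y} := by
    rw [hP, withDensity_apply _ hm]
    calc _ = ∫⁻ _ in {y | c < r y}, ENNReal.ofReal c ∂ν := by simp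
      _ ≤ _ := setLIntegral_mono (by fun_prop) fun y hy =>
          ENNReal.ofReal_le_ofReal (le_of_lt hy)
  have h2 := ENNReal.toReal_mono ENNReal.one_ne_top (h1.trans prob_le_one)
  rwa [ENNReal.toReal_mul, ENNReal.toReal_ofReal hc] at h2

/-- Markov-type tail bound for the log-likelihood ratio. -/
lemma mul_measureReal_exp_lt_density_le {P ν : Measure T} [IsProbabilityMeasure P]
    [IsProbabilityMeasure ν] {r : T → ℝ}
    (hr : Measurable r) (hP : P = ν.withDensity fun ω => ENNReal.ofReal (r ω))
    (hlr : Integrable (fun ω => Real.log (r ω)) P) {l : ℝ} (hl : 0 ≤ l) :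
    l * P.real {y | Real.exp l < r y} ≤ ∫ ω, Real.log (r ω) ∂P + 1 := by
  -- As `log r` may be negative, Markov's inequality does not apply to it directly. The event bound
  -- replaces it, and its exponential factor is cancelled by `h2`, at the price of the summand `1`.
  have h1 := mul_measureReal_le_of_density hr hP hlr
    (measurableSet_lt measurable_const hr : MeasurableSet {y | Real.exp l < r y}) hl
  have h2 := mul_measureReal_lt_density_le_one hr hP (Real.exp l) (Real.exp_pos l).le
  have h3 : 0 ≤ ν.real {y | Real.exp l < r y} := measureReal_nonneg
  linarith

/-- The deviation is below `τ` off the bad set and at most `1` on it, both means lying in `[0, 1]`.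
-/
lemma abs_integral_empMean_sub_le (P : Measure S) [IsProbabilityMeasure P] (B : Measure T)
    [IsProbabilityMeasure B] {F : S × T → ℝ} (hF : Measurable F)
    (hb : ∀ p, F p ∈ Set.Icc (0 : ℝ) 1) {t : ℕ} {τ : ℝ} (hτ : 0 ≤ τ) (s : Fin t → S) :
    |∫ y, empMean (fun x => F (x, y)) s ∂B - ∫ y, ∫ x, F (x, y) ∂P ∂B|
      ≤ τ + B.real (badSet P F τ s) := by
  have hm1 : Measurable fun y : T => empMean (fun x => F (x, y)) s := by
    unfold empMean
    refine Measurable.div_const (Finset.measurable_sum _ fun i _ => ?_) _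
    exact hF.comp (by fun_prop)
  have hm2 : Measurable fun y : T => ∫ x, F (x, y) ∂P :=
    hF.stronglyMeasurable.integral_prod_left'.measurable
  have hb1 : ∀ y, empMean (fun x => F (x, y)) s ∈ Set.Icc (0 : ℝ) 1 :=
    fun y => empMean_mem_Icc (fun x => hb _) s
  have hb2 : ∀ y, ∫ x, F (x, y) ∂P ∈ Set.Icc (0 : ℝ) 1 := fun y => by
    have hi : Integrable (fun x => F (x, y)) P := Integrable.of_mem_Icc 0 1
      (hF.comp (by fun_prop : Measurable fun x : S => (x, y))).aemeasurable
      (Filter.Eventually.of_forall fun x => hb _)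
    refine ⟨integral_nonneg fun x => (hb _).1, ?_⟩
    calc ∫ x, F (x, y) ∂P ≤ ∫ _, (1 : ℝ) ∂P := integral_mono hi (integrable_const 1)
          fun x => (hb _).2
      _ = 1 := by simp
  have hi1 := Integrable.of_mem_Icc (μ := B) 0 1 hm1.aemeasurable (Filter.Eventually.of_forall hb1)
  have hi2 := Integrable.of_mem_Icc (μ := B) 0 1 hm2.aemeasurable (Filter.Eventually.of_forall hb2)
  have hE : MeasurableSet (badSet P F τ s) :=
    measurableSet_le measurable_const ((hm1.sub hm2).abs)
  rw [← integral_sub hi1 hi2]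
  calc _ ≤ ∫ y, |empMean (fun x => F (x, y)) s - ∫ x, F (x, y) ∂P| ∂B :=
        abs_integral_le_integral_abs
    _ ≤ ∫ y, (τ + (badSet P F τ s).indicator (fun _ => (1 : ℝ)) y) ∂B := by
        refine integral_mono (hi1.sub hi2).abs
          ((integrable_const τ).add ((integrable_const 1).indicator hE)) fun y => ?_
        by_cases hy : y ∈ badSet P F τ s
        · simp only [Set.indicator_of_mem hy]
          have h : |empMean (fun x => F (x, y)) s - ∫ x, F (x, y) ∂P| ≤ 1 := by
            rw [abs_le]; constructor <;> linarith [(hb1 y).1, (hb1 y).2, (hb2 y).1, (hb2 y).2]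
          linarith
        · simp only [Set.indicator_of_notMem hy, add_zero]
          exact (not_le.mp hy).le
    _ = _ := by
        rw [integral_add (integrable_const τ) ((integrable_const 1).indicator hE),
          integral_indicator_const _ hE]
        simp

end Sampling

/-! ### Decoding Alice's input from samples of her message. -/

section Decoding

variable {S T : Type*} [MeasurableSpace S] [MeasurableSpace T]

/-- The event bound for `t` independent samples: relative entropy is additive. -/
lemma mul_measureReal_pi_le_of_density {P ν : Measure S} [IsProbabilityMeasure P]
    [IsProbabilityMeasure ν] {r : S → ℝ} (hr : Measurable r) (hr0 : ∀ s, 0 ≤ r s)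
    (hP : P = ν.withDensity fun ω => ENNReal.ofReal (r ω))
    (hlr : Integrable (fun ω => Real.log (r ω)) P) {t : ℕ} {G : Set (Fin t → S)}
    (hG : MeasurableSet G) {l : ℝ} (hl : 0 ≤ l) :
    l * (Measure.pi fun _ : Fin t => P).real G ≤
      t * ∫ ω, Real.log (r ω) ∂P +
        (Real.exp l - 1) * (Measure.pi fun _ : Fin t => ν).real G := by
  have hpi : (Measure.pi fun _ : Fin t => P) = (Measure.pi fun _ : Fin t => ν).withDensity
      fun s => ENNReal.ofReal (∏ i, r (s i)) := by
    have : SigmaFinite (ν.withDensity fun ω => ENNReal.ofReal (r ω)) := by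
      rw [← hP]; infer_instance
    have h := pi_withDensity (ι := Fin t) ν (f := fun ω => ENNReal.ofReal (r ω)) (by fun_prop)
    rw [← hP] at h
    rw [h]
    congr 1
    ext s
    rw [ENNReal.ofReal_prod_of_nonneg fun i _ => hr0 _]
  have hpos : ∀ᵐ s ∂(Measure.pi fun _ : Fin t => P), ∀ i, 0 < r (s i) := by
    rw [ae_all_iff]
    intro i
    exact (measurePreserving_eval (fun _ : Fin t => P) i).quasiMeasurePreserving.ae
      (ae_density_pos hr hP)
  have hlog : (fun s : Fin t → S => Real.log (∏ i, r (s i)))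
      =ᵐ[Measure.pi fun _ : Fin t => P] fun s => ∑ i, Real.log (r (s i)) := by
    filter_upwards [hpos] with s hs
    exact Real.log_prod fun i _ => (hs i).ne'
  have hi : ∀ i : Fin t, Integrable (fun s : Fin t → S => Real.log (r (s i)))
      (Measure.pi fun _ : Fin t => P) := fun i =>
    (measurePreserving_eval (fun _ : Fin t => P) i).integrable_comp_of_integrable hlr
  have hval : ∫ s, Real.log (∏ i, r (s i)) ∂(Measure.pi fun _ : Fin t => P)
      = t * ∫ ω, Real.log (r ω) ∂P := by
    rw [integral_congr_ae hlog, integral_finsetSum _ fun i _ => hi i]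
    have : ∀ i : Fin t, ∫ s : Fin t → S, Real.log (r (s i)) ∂(Measure.pi fun _ : Fin t => P)
        = ∫ ω, Real.log (r ω) ∂P := fun i =>
      integral_comp_eval (μ := fun _ : Fin t => P) hlr.aestronglyMeasurable
    simp [this]
  rw [← hval]
  refine mul_measureReal_le_of_density ?_ hpi ?_ hG hl
  · exact Finset.measurable_prod _ fun i _ => hr.comp (measurable_pi_apply i)
  · exact (integrable_congr hlog).mpr (integrable_finsetSum _ fun i _ => hi i)

variable {X : Type*}

/-- The acceptance probability that the sample `s` of Alice's messages predicts for a message of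
Bob with law `B`. -/
def predicted (F : S × T → ℝ) (B : Measure T) {t : ℕ} (s : Fin t → S) : ℝ :=
  ∫ y, empMean (fun x => F (x, y)) s ∂B

lemma measurable_predicted {F : S × T → ℝ} (hF : Measurable F) (B : Measure T)
    [IsProbabilityMeasure B] (t : ℕ) :
    Measurable fun s : Fin t → S => predicted F B s := by
  have h1 : Measurable fun p : (Fin t → S) × T => empMean (fun x => F (x, p.2)) p.1 := by
    unfold empMean
    refine Measurable.div_const (Finset.measurable_sum _ fun i _ => ?_) _
    exact hF.comp (by fun_prop)
  exact h1.stronglyMeasurable.integral_prod_right'.measurable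

/-- The samples of Alice's messages that single out the input `x` among those in `K`. -/
def decodeSet (F : S × T → ℝ) (B : X → Measure T) (K : Finset X) (t : ℕ) (x : X) :
    Set (Fin t → S) :=
  {s | x ∈ K ∧ 1 / 2 < predicted F (B x) s ∧ ∀ y ∈ K, y ≠ x → predicted F (B y) s < 1 / 2}

lemma measurableSet_decodeSet {F : S × T → ℝ} (hF : Measurable F) (B : X → Measure T)
    [∀ x, IsProbabilityMeasure (B x)] (K : Finset X) (t : ℕ) (x : X) :
    MeasurableSet (decodeSet F B K t x) := by
  have h : decodeSet F B K t x = {_s | x ∈ K} ∩ ({s | 1 / 2 < predicted F (B x) s} ∩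
      ⋂ y ∈ K, ⋂ (_ : y ≠ x), {s | predicted F (B y) s < 1 / 2}) := by
    ext s; simp [decodeSet]
  rw [h]
  refine (MeasurableSet.const _).inter ((measurableSet_lt measurable_const
    (measurable_predicted hF _ t)).inter ?_)
  refine Finset.measurableSet_biInter _ fun y _ => MeasurableSet.iInter fun _ => ?_
  exact measurableSet_lt (measurable_predicted hF _ t) measurable_const

/-- The sets are disjoint: a sample decoding to `x` predicts more than `1/2` at `x`, one decoding to
another input predicts less there. -/
lemma sum_measureReal_decodeSet_le [Fintype X] {F : S × T → ℝ} (hF : Measurable F) (B : X → Measure T)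
    [∀ x, IsProbabilityMeasure (B x)] (K : Finset X) (t : ℕ) (ν : Measure (Fin t → S))
    [IsProbabilityMeasure ν] : ∑ x, ν.real (decodeSet F B K t x) ≤ 1 := by
  rw [← measureReal_biUnion_finset]
  · exact measureReal_le_one
  · intro x _ y _ hxy
    rw [Function.onFun, Set.disjoint_left]
    rintro s ⟨hx, h1, -⟩ ⟨-, -, h2⟩
    exact absurd (h2 x hx hxy) (by linarith)
  · exact fun x _ => measurableSet_decodeSet hF B K t x

/-- If the bad set of the sample has `Q`-mass below `κ * exp (-l)`, its mass under `B y` is below `d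
+ κ` for each `y ∈ K`. All predictions are then off by less than `τ + d + κ = 1/2 - ε`, exactly the
distance from `ε` and from `1 - ε` to the threshold `1/2`. -/
lemma le_measureReal_decodeSet {A : X → Measure S} {B : X → Measure T}
    [∀ x, IsProbabilityMeasure (A x)] [∀ x, IsProbabilityMeasure (B x)]
    {Q : Measure T} [IsProbabilityMeasure Q] {g : X → T → ℝ} (hg : ∀ x, Measurable (g x))
    (hB : ∀ x, B x = Q.withDensity fun ω => ENNReal.ofReal (g x ω))
    {F : S × T → ℝ} (hF : Measurable F) (hb : ∀ p, F p ∈ Set.Icc (0 : ℝ) 1)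
    {ε d κ τ l : ℝ} (hκ : 0 < κ) (hτ : 0 ≤ τ) (hsum : τ + d + κ + ε = 1 / 2)
    (hacc : ∀ x, 1 - ε ≤ ∫ y, ∫ z, F (z, y) ∂A x ∂B x)
    (hrej : ∀ x y, x ≠ y → ∫ z, ∫ w, F (w, z) ∂A x ∂B y ≤ ε)
    {t : ℕ} (ht : 0 < t) (hlt : l + Real.log (64 / κ) ≤ 2 * τ ^ 2 * t) {K : Finset X}
    (hK : ∀ y ∈ K, (B y).real {z | Real.exp l < g y z} ≤ d) {x : X} (hx : x ∈ K) :
    31 / 32 ≤ (Measure.pi fun _ : Fin t => A x).real (decodeSet F B K t x) := by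
  have hθ : 0 < κ * Real.exp (-l) := by positivity
  have hbad := measureReal_badSet_ge_le (A x) Q hF hb ht hτ hθ
  -- The `64` in `hlt` cancels the factor `2` of the two-sided tail and leaves failure probability
  -- `1/32`.
  have hnum : 2 * Real.exp (-(2 * τ ^ 2 * t)) / (κ * Real.exp (-l)) ≤ 1 / 32 := by
    rw [div_le_iff₀ hθ]
    have : Real.exp (-(2 * τ ^ 2 * t)) ≤ Real.exp (-l + Real.log (κ / 64)) := by
      apply Real.exp_le_exp.mpr
      have : Real.log (κ / 64) = -Real.log (64 / κ) := by rw [← Real.log_inv, inv_div]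
      linarith
    rw [Real.exp_add, Real.exp_log (by positivity)] at this
    linarith
  have hsub : (decodeSet F B K t x)ᶜ ⊆
      {s | κ * Real.exp (-l) ≤ Q.real (badSet (A x) F τ s)} := by
    intro s hs
    by_contra hlow
    apply hs
    have hlow' : Q.real (badSet (A x) F τ s) < κ * Real.exp (-l) := not_le.mp hlow
    have hE : MeasurableSet (badSet (A x) F τ s) :=
      (measurableSet_prod_badSet (A x) hF τ t).preimage
        (by fun_prop : Measurable fun y : T => (s, y))
    have hclose : ∀ y ∈ K,
        |predicted F (B y) s - ∫ z, ∫ w, F (w, z) ∂A x ∂B y| < τ + d + κ := fun y hy => by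
      have h1 := abs_integral_empMean_sub_le (A x) (B y) hF hb hτ s
      have h2 := measureReal_le_of_density (hg y) (hB y) hE (Real.exp l) (Real.exp_pos l).le
      have h3 : Real.exp l * Q.real (badSet (A x) F τ s) < κ := by
        calc _ < Real.exp l * (κ * Real.exp (-l)) := by gcongr
          _ = κ := by rw [Real.exp_neg]; field_simp
      have h4 := hK y hy
      unfold predicted
      linarith
    refine ⟨hx, ?_, fun y hy hne => ?_⟩
    · have := (abs_lt.mp (hclose x hx)).1
      linarith [hacc x]
    · have := (abs_lt.mp (hclose y hy)).2
      linarith [hrej x y hne.symm]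
  have hc := probReal_compl_eq_one_sub (μ := Measure.pi fun _ : Fin t => A x)
    (measurableSet_decodeSet hF B K t x)
  have := measureReal_mono (μ := Measure.pi fun _ : Fin t => A x) hsub
  linarith

/-- The trade-off between the information in Alice's and in Bob's messages in any protocol for
equality. -/
theorem log_card_le [Fintype X] [Nonempty X] {A : X → Measure S} {B : X → Measure T}
    [∀ x, IsProbabilityMeasure (A x)] [∀ x, IsProbabilityMeasure (B x)]
    {QA : Measure S} {QB : Measure T} [IsProbabilityMeasure QA] [IsProbabilityMeasure QB]
    {f : X → S → ℝ} (hf : ∀ x, Measurable (f x)) (hf0 : ∀ x s, 0 ≤ f x s)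
    (hA : ∀ x, A x = QA.withDensity fun ω => ENNReal.ofReal (f x ω))
    (hlf : ∀ x, Integrable (fun ω => Real.log (f x ω)) (A x))
    {g : X → T → ℝ} (hg : ∀ x, Measurable (g x))
    (hB : ∀ x, B x = QB.withDensity fun ω => ENNReal.ofReal (g x ω))
    (hlg : ∀ x, Integrable (fun ω => Real.log (g x ω)) (B x))
    {F : S × T → ℝ} (hF : Measurable F) (hb : ∀ p, F p ∈ Set.Icc (0 : ℝ) 1)
    {ε d κ τ a b : ℝ} (hd : 0 < d) (hκ : 0 < κ) (hτ : 0 ≤ τ) (hsum : τ + d + κ + ε = 1 / 2)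
    (hacc : ∀ x, 1 - ε ≤ ∫ y, ∫ z, F (z, y) ∂A x ∂B x)
    (hrej : ∀ x y, x ≠ y → ∫ z, ∫ w, F (w, z) ∂A x ∂B y ≤ ε)
    (ha : ∑ x, ∫ ω, Real.log (f x ω) ∂A x = Fintype.card X * a)
    (hb' : ∑ x, ∫ ω, Real.log (g x ω) ∂B x = Fintype.card X * b) (hb0 : 0 ≤ b)
    {t : ℕ} (ht : 0 < t) (hlt : 2 * (b + 1) / d + Real.log (64 / κ) ≤ 2 * τ ^ 2 * t) :
    31 / 64 * Real.log (Fintype.card X) ≤ t * a + 1 := by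
  classical
  set N : ℝ := (Fintype.card X : ℝ) with hN
  have hN1 : 1 ≤ N := by rw [hN]; exact_mod_cast Fintype.card_pos (α := X)
  set l := 2 * (b + 1) / d with hl
  have hl0 : 0 < l := by positivity
  -- Inputs of Bob whose log-likelihood ratio rarely exceeds `l`. With `l = 2 (b + 1) / d`,
  -- averaging the tail bound excludes at most half of all inputs.
  set K : Finset X := Finset.univ.filter fun y => (B y).real {z | Real.exp l < g y z} ≤ d
  have hK : ∀ y ∈ K, (B y).real {z | Real.exp l < g y z} ≤ d := fun y hy =>
    (Finset.mem_filter.mp hy).2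
  have hKcard : N / 2 ≤ K.card := by
    have h1 : ∀ y, l * (B y).real {z | Real.exp l < g y z} ≤ ∫ ω, Real.log (g y ω) ∂B y + 1 :=
      fun y => mul_measureReal_exp_lt_density_le (hg y) (hB y) (hlg y) hl0.le
    have h2 : l * ∑ y, (B y).real {z | Real.exp l < g y z} ≤ N * b + N := by
      rw [Finset.mul_sum, ← hb']
      refine (Finset.sum_le_sum fun y _ => h1 y).trans (le_of_eq ?_)
      rw [Finset.sum_add_distrib]
      simp [hN]
    have h3 : ((Kᶜ).card : ℝ) * d ≤ ∑ y, (B y).real {z | Real.exp l < g y z} := by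
      calc ((Kᶜ).card : ℝ) * d = ∑ y ∈ Kᶜ, d := by simp
        _ ≤ ∑ y ∈ Kᶜ, (B y).real {z | Real.exp l < g y z} := by
            refine Finset.sum_le_sum fun y hy => ?_
            simp only [K, Finset.mem_compl, Finset.mem_filter, Finset.mem_univ, true_and,
              not_le] at hy
            exact hy.le
        _ ≤ _ := Finset.sum_le_sum_of_subset_of_nonneg (Finset.subset_univ _)
            fun _ _ _ => measureReal_nonneg
    have h4 : (K.card : ℝ) + (Kᶜ).card = N := by
      rw [hN]; exact_mod_cast Finset.card_add_card_compl K
    have h5 : l * (((Kᶜ).card : ℝ) * d) ≤ N * b + N :=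
      (mul_le_mul_of_nonneg_left h3 hl0.le).trans h2
    have h6 : l * (((Kᶜ).card : ℝ) * d) = 2 * (b + 1) * (Kᶜ).card := by
      rw [hl]; field_simp
    rw [h6] at h5
    have h7 : ((Kᶜ).card : ℝ) ≤ N / 2 := by
      have : (b + 1) * (2 * ((Kᶜ).card : ℝ)) ≤ (b + 1) * N := by linarith
      have := le_of_mul_le_mul_left this (by linarith)
      linarith
    linarith
  have hlogN : 0 ≤ Real.log N := Real.log_nonneg hN1
  -- The event bound is used with `l = log N`. Summed over the disjoint decoding sets, the
  -- `QA`-terms contribute at most `N - 1`, that is, less than `1` per input.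
  have hx : ∀ x, Real.log N * (Measure.pi fun _ : Fin t => A x).real (decodeSet F B K t x) ≤
      t * ∫ ω, Real.log (f x ω) ∂A x +
        (N - 1) * (Measure.pi fun _ : Fin t => QA).real (decodeSet F B K t x) := fun x => by
    have := mul_measureReal_pi_le_of_density (hf x) (hf0 x) (hA x) (hlf x)
      (measurableSet_decodeSet hF B K t x) hlogN
    rwa [Real.exp_log (by linarith)] at this
  have hlow : N / 2 * (31 / 32) ≤
      ∑ x, (Measure.pi fun _ : Fin t => A x).real (decodeSet F B K t x) := by
    calc N / 2 * (31 / 32) ≤ K.card * (31 / 32) := by gcongr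
      _ = ∑ x ∈ K, (31 / 32 : ℝ) := by simp
      _ ≤ ∑ x ∈ K, (Measure.pi fun _ : Fin t => A x).real (decodeSet F B K t x) :=
          Finset.sum_le_sum fun x hx => le_measureReal_decodeSet hg hB hF hb hκ hτ hsum hacc hrej
            ht hlt hK hx
      _ ≤ _ := Finset.sum_le_sum_of_subset_of_nonneg (Finset.subset_univ _)
          fun _ _ _ => measureReal_nonneg
  have hup := Finset.sum_le_sum fun x (_ : x ∈ Finset.univ) => hx x
  rw [← Finset.mul_sum, Finset.sum_add_distrib, ← Finset.mul_sum, ← Finset.mul_sum, ha] at hup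
  have hdis := sum_measureReal_decodeSet_le hF B K t (Measure.pi fun _ : Fin t => QA)
  have h1 := mul_le_mul_of_nonneg_left hlow hlogN
  have h2 := mul_le_mul_of_nonneg_left hdis (by linarith : 0 ≤ N - 1)
  have h3 : N * (31 / 64 * Real.log N) ≤ N * (t * a + 1) := by linarith
  exact le_of_mul_le_mul_left h3 (by linarith)

end Decoding

/-! ### Uniform mixtures and densities with respect to them. -/

section Mixture

variable {ι S T : Type*} [Fintype ι] [MeasurableSpace S] [MeasurableSpace T]

/-- The uniform mixture of a finite family of measures. -/
def mixture (A : ι → Measure S) : Measure S := (Fintype.card ι : ℝ≥0∞)⁻¹ • ∑ x, A x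

lemma mixture_apply (A : ι → Measure S) (s : Set S) :
    mixture A s = (Fintype.card ι : ℝ≥0∞)⁻¹ * ∑ x, A x s := by
  simp [mixture, Measure.finsetSum_apply]

instance [Nonempty ι] (A : ι → Measure S) [∀ x, IsProbabilityMeasure (A x)] :
    IsProbabilityMeasure (mixture A) := by
  refine ⟨?_⟩
  rw [mixture_apply]
  simp [ENNReal.inv_mul_cancel]

lemma mixture_map (A : ι → Measure S) {φ : S → T} (hφ : Measurable φ) :
    (mixture A).map φ = mixture fun x => (A x).map φ := by
  ext s hs
  rw [Measure.map_apply hφ hs]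
  simp [mixture_apply, Measure.map_apply hφ hs]

lemma mixture_prod (A : ι → Measure S) [∀ x, IsProbabilityMeasure (A x)] (ρ : Measure T)
    [IsProbabilityMeasure ρ] :
    (mixture A).prod ρ = mixture fun x => (A x).prod ρ := by
  ext s hs
  rw [mixture_apply, mixture, Measure.prod_smul_left, Measure.smul_apply, smul_eq_mul]
  congr 1
  rw [Measure.prod_apply hs, lintegral_finsetSum_measure]
  simp_rw [Measure.prod_apply hs]

lemma mixture_prod_mixture [Nonempty ι] (A : ι → Measure S) (B : ι → Measure T)
    [∀ x, IsProbabilityMeasure (A x)] [∀ x, IsProbabilityMeasure (B x)] :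
    (mixture A).prod (mixture B) = mixture fun w : ι × ι => (A w.1).prod (B w.2) := by
  refine Measure.prod_eq fun s t hs ht => ?_
  simp only [mixture_apply, Measure.prod_prod, Fintype.card_prod, Fintype.sum_prod_type,
    Nat.cast_mul]
  rw [← Finset.sum_mul_sum, ENNReal.mul_inv (by simp) (by simp)]
  ring

lemma integral_mixture [Nonempty ι] {A : ι → Measure S} {φ : S → ℝ}
    (h : ∀ x, Integrable φ (A x)) :
    ∫ s, φ s ∂(mixture A) = (∑ x, ∫ s, φ s ∂A x) / Fintype.card ι := by
  rw [mixture, integral_smul_measure, integral_finsetSum_measure fun x _ => h x]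
  simp [div_eq_inv_mul]

lemma integrable_mixture [Nonempty ι] {A : ι → Measure S} {φ : S → ℝ}
    (h : ∀ x, Integrable φ (A x)) : Integrable φ (mixture A) := by
  refine Integrable.smul_measure ?_ (by simp)
  exact integrable_finsetSum_measure.mpr fun x _ => h x

/-- Each `A x` is at most `card ι` times the mixture, so its density is bounded by `card ι`; this
makes the log-density integrable and all relative entropies finite. -/
lemma exists_mixture_density [Nonempty ι] (A : ι → Measure S) [∀ x, IsProbabilityMeasure (A x)] :
    ∃ f : ι → S → ℝ, (∀ x, Measurable (f x)) ∧ (∀ x s, 0 ≤ f x s) ∧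
      (∀ x, A x = (mixture A).withDensity fun s => ENNReal.ofReal (f x s)) ∧
      ∀ x, Integrable (fun s => Real.log (f x s)) (A x) := by
  have hle : ∀ x, A x ≤ (Fintype.card ι : ℝ≥0∞) • mixture A := fun x => by
    rw [mixture, smul_smul, ENNReal.mul_inv_cancel (by simp) (by simp), one_smul]
    intro s
    rw [Measure.finsetSum_apply]
    exact Finset.single_le_sum (f := fun y => A y s) (fun _ _ => zero_le) (Finset.mem_univ x)
  have hac : ∀ x, A x ≪ mixture A := fun x =>
    (Measure.absolutelyContinuous_of_le (hle x)).trans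
      (Measure.smul_absolutelyContinuous)
  have hbd : ∀ x, ∀ᵐ s ∂(mixture A), (A x).rnDeriv (mixture A) s ≤ Fintype.card ι := fun x => by
    refine ae_le_of_forall_setLIntegral_le_of_sigmaFinite (Measure.measurable_rnDeriv _ _)
      fun s _ _ => (Measure.setLIntegral_rnDeriv_le s).trans ?_
    simpa using hle x s
  have hden : ∀ x, A x = (mixture A).withDensity
      fun s => ENNReal.ofReal ((A x).rnDeriv (mixture A) s).toReal := fun x => by
    conv_lhs => rw [← Measure.withDensity_rnDeriv_eq _ _ (hac x)]
    refine withDensity_congr_ae ?_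
    filter_upwards [hbd x] with s hs
    rw [ENNReal.ofReal_toReal (ne_top_of_le_ne_top (by simp) hs)]
  have hm : ∀ x, Measurable fun s => ((A x).rnDeriv (mixture A) s).toReal := fun x =>
    (Measure.measurable_rnDeriv _ _).ennreal_toReal
  refine ⟨fun x s => ((A x).rnDeriv (mixture A) s).toReal, hm,
    fun x s => ENNReal.toReal_nonneg, hden, fun x => ?_⟩
  refine integrable_log_density (C := Fintype.card ι) (hm x) (hden x) ?_
  filter_upwards [(hac x).ae_le (hbd x)] with s hs
  simpa using ENNReal.toReal_mono (by simp) hs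

end Mixture

/-! ### Additivity of information for independent inputs. -/

section Leakage

variable {X S T : Type*} [Fintype X] [MeasurableSpace X] [MeasurableSpace S] [MeasurableSpace T]

lemma log_density_integral_nonneg {P ν : Measure S} [IsProbabilityMeasure P]
    [IsProbabilityMeasure ν] {r : S → ℝ}
    (hr : Measurable r) (hP : P = ν.withDensity fun ω => ENNReal.ofReal (r ω))
    (hlr : Integrable (fun ω => Real.log (r ω)) P) : 0 ≤ ∫ ω, Real.log (r ω) ∂P := by
  simpa using mul_measureReal_le_of_density hr hP hlr MeasurableSet.univ le_rfl

/-- Gibbs' variational inequality for `klDiv`. -/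
lemma ofReal_integral_log_le_klDiv {P ν : Measure S} [IsProbabilityMeasure P]
    [IsProbabilityMeasure ν] {u : S → ℝ} (hu : Measurable u)
    (hpos : ∀ᵐ ω ∂P, 0 < u ω) (hlu : Integrable (fun ω => Real.log (u ω)) P)
    (huν : ∫⁻ ω, ENNReal.ofReal (u ω) ∂ν ≤ 1) :
    ENNReal.ofReal (∫ ω, Real.log (u ω) ∂P) ≤ InformationTheory.klDiv P ν := by
  by_cases htop : InformationTheory.klDiv P ν = ∞
  · simp [htop]
  obtain ⟨hac, hint⟩ := InformationTheory.klDiv_ne_top_iff.mp htop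
  rw [← ENNReal.ofReal_toReal htop,
    InformationTheory.toReal_klDiv_of_measure_eq hac (by simp)]
  refine ENNReal.ofReal_le_ofReal ?_
  have hden : P = ν.withDensity fun s => ENNReal.ofReal (P.rnDeriv ν s).toReal := by
    conv_lhs => rw [← Measure.withDensity_rnDeriv_eq _ _ hac]
    refine withDensity_congr_ae ?_
    filter_upwards [P.rnDeriv_lt_top ν] with s hs
    rw [ENNReal.ofReal_toReal hs.ne]
  have := integral_log_le_of_density (c := 1) (Measure.measurable_rnDeriv P ν).ennreal_toReal hden
    hint hu hpos hlu zero_le_one (by simpa using huν)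
  simpa [llr] using this

/-- For independent uniform inputs and messages that are conditionally independent given the inputs,
the two informations add up. -/
lemma ofReal_add_le_klDiv [Nonempty X] [DiscreteMeasurableSpace X]
    {A : X → Measure S} {B : X → Measure T}
    [∀ x, IsProbabilityMeasure (A x)] [∀ x, IsProbabilityMeasure (B x)]
    {f : X → S → ℝ} (hf : ∀ x, Measurable (f x)) (hf0 : ∀ x s, 0 ≤ f x s)
    (hA : ∀ x, A x = (mixture A).withDensity fun ω => ENNReal.ofReal (f x ω))
    (hlf : ∀ x, Integrable (fun ω => Real.log (f x ω)) (A x))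
    {g : X → T → ℝ} (hg : ∀ x, Measurable (g x))
    (hB : ∀ x, B x = (mixture B).withDensity fun ω => ENNReal.ofReal (g x ω))
    (hlg : ∀ x, Integrable (fun ω => Real.log (g x ω)) (B x))
    {a b : ℝ} (ha : ∑ x, ∫ ω, Real.log (f x ω) ∂A x = Fintype.card X * a)
    (hb : ∑ x, ∫ ω, Real.log (g x ω) ∂B x = Fintype.card X * b) :
    ENNReal.ofReal (a + b) ≤ InformationTheory.klDiv
      (mixture fun w : X × X => (Measure.dirac w).prod ((A w.1).prod (B w.2)))
      ((mixture fun w : X × X => Measure.dirac w).prod ((mixture A).prod (mixture B))) := by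
  -- The expected likelihood ratio of the joint law to the product law. For the lower bound it need
  -- not be identified as such: as a test function in Gibbs' inequality it only has to have integral
  -- at most one under the product law.
  let v : (X × X) × (S × T) → ℝ := fun p => f p.1.1 p.2.1 * g p.1.2 p.2.2
  have hv : Measurable v := by
    refine measurable_from_prod_countable_right fun w => ?_
    exact ((hf w.1).comp measurable_fst).mul ((hg w.2).comp measurable_snd)
  have hlv : Measurable fun p => Real.log (v p) := Real.measurable_log.comp hv
  have hvw : ∀ w : X × X, ∀ᵐ p ∂((A w.1).prod (B w.2)), 0 < f w.1 p.1 ∧ 0 < g w.2 p.2 :=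
    fun w => by
      filter_upwards [Measure.quasiMeasurePreserving_fst.ae (ae_density_pos (hf w.1) (hA w.1)),
        Measure.quasiMeasurePreserving_snd.ae (ae_density_pos (hg w.2) (hB w.2))] with p h1 h2
      exact ⟨h1, h2⟩
  have hlog : ∀ w : X × X, (fun p => Real.log (v (w, p))) =ᵐ[(A w.1).prod (B w.2)]
      fun p => Real.log (f w.1 p.1) + Real.log (g w.2 p.2) := fun w => by
    filter_upwards [hvw w] with p hp
    exact Real.log_mul hp.1.ne' hp.2.ne'
  have hi : ∀ w : X × X, Integrable (fun p => Real.log (v p))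
      ((Measure.dirac w).prod ((A w.1).prod (B w.2))) := fun w => by
    rw [Measure.dirac_prod, integrable_map_measure
      hlv.aestronglyMeasurable (by fun_prop)]
    exact (integrable_congr (hlog w)).mpr ((hlf w.1).comp_fst _ |>.add ((hlg w.2).comp_snd _))
  have hval : ∀ w : X × X, ∫ p, Real.log (v p) ∂((Measure.dirac w).prod ((A w.1).prod (B w.2)))
      = ∫ s, Real.log (f w.1 s) ∂A w.1 + ∫ s, Real.log (g w.2 s) ∂B w.2 := fun w => by
    rw [Measure.dirac_prod, integral_map (by fun_prop)
      hlv.aestronglyMeasurable, integral_congr_ae (hlog w),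
      integral_add ((hlf w.1).comp_fst _) ((hlg w.2).comp_snd _)]
    congr 1
    · rw [integral_fun_fst (fun s => Real.log (f w.1 s))]; simp
    · rw [integral_fun_snd (fun s => Real.log (g w.2 s))]; simp
  have hN : (Fintype.card X : ℝ) ≠ 0 := by simp
  have htot : ∫ p, Real.log (v p) ∂(mixture fun w : X × X =>
      (Measure.dirac w).prod ((A w.1).prod (B w.2))) = a + b := by
    rw [integral_mixture hi]
    simp_rw [hval]
    simp only [Fintype.sum_prod_type, Finset.sum_add_distrib, Finset.sum_const,
      Finset.card_univ, nsmul_eq_mul, ← Finset.mul_sum, ha, hb, Fintype.card_prod, Nat.cast_mul]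
    field_simp
  rw [← htot]
  refine ofReal_integral_log_le_klDiv hv ?_ (integrable_mixture hi) ?_
  · refine Measure.ae_smul_measure ?_ _
    rw [← Measure.sum_fintype, Measure.ae_sum_iff]
    intro w
    rw [Measure.dirac_prod, ae_map_iff (by fun_prop) (measurableSet_lt measurable_const hv)]
    filter_upwards [hvw w] with p hp
    exact mul_pos hp.1 hp.2
  · rw [lintegral_prod _ (by fun_prop)]
    have h1 : ∀ w : X × X, ∫⁻ p, ENNReal.ofReal (v (w, p)) ∂(mixture A).prod (mixture B) = 1 :=
      fun w => by
        have hA1 : ∫⁻ s, ENNReal.ofReal (f w.1 s) ∂mixture A = 1 := by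
          have := congrArg (fun m => m Set.univ) (hA w.1)
          simpa using this.symm
        have hB1 : ∫⁻ s, ENNReal.ofReal (g w.2 s) ∂mixture B = 1 := by
          have := congrArg (fun m => m Set.univ) (hB w.2)
          simpa using this.symm
        simp_rw [v, ENNReal.ofReal_mul (hf0 _ _)]
        rw [lintegral_prod_mul (f := fun s => ENNReal.ofReal (f w.1 s))
          (g := fun s => ENNReal.ofReal (g w.2 s)) (hf _).ennreal_ofReal.aemeasurable
          (hg _).ennreal_ofReal.aemeasurable, hA1, hB1, one_mul]
    simp [h1]

end Leakage

/-! ### Laws of the players' views in a protocol. -/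

lemma measurePreserving_prod_left_comm {α β γ : Type*} [MeasurableSpace α] [MeasurableSpace β]
    [MeasurableSpace γ] (μ : Measure α) (ν : Measure β) (ρ : Measure γ) [IsProbabilityMeasure μ]
    [IsProbabilityMeasure ν] [IsProbabilityMeasure ρ] :
    MeasurePreserving (fun p : α × β × γ => (p.2.1, p.1, p.2.2)) (μ.prod (ν.prod ρ))
      (ν.prod (μ.prod ρ)) :=
  (measurePreserving_prodAssoc ν μ ρ).comp
    (((Measure.measurePreserving_swap (μ := μ) (ν := ν)).prod (MeasurePreserving.id ρ)).comp
      (measurePreserving_prodAssoc μ ν ρ).symm)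

namespace Protocol

variable {X Y Z : Type} [MeasurableSpace X] [MeasurableSpace Y] [MeasurableSpace Z]

instance (P : Protocol.{u} X Y Z) : IsProbabilityMeasure P.randLaw := by
  unfold randLaw; infer_instance

/-- Alice's message on input `x`, together with the string shared with the referee. -/
def aliceView (P : Protocol.{u} X Y Z) (x : X) (r : P.RA × P.RAC) : P.MA × P.RAC :=
  (P.alice (x, r.1, r.2), r.2)

/-- Bob's message on input `y`, together with the string shared with the referee. -/
def bobView (P : Protocol.{u} X Y Z) (y : Y) (r : P.RB × P.RBC) : P.MB × P.RBC :=
  (P.bob (y, r.1, r.2), r.2)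

lemma measurable_aliceView (P : Protocol.{u} X Y Z) (x : X) : Measurable (P.aliceView x) :=
  (P.measurable_alice.comp (by fun_prop)).prodMk measurable_snd

lemma measurable_bobView (P : Protocol.{u} X Y Z) (y : Y) : Measurable (P.bobView y) :=
  (P.measurable_bob.comp (by fun_prop)).prodMk measurable_snd

def aliceLaw (P : Protocol.{u} X Y Z) (x : X) : Measure (P.MA × P.RAC) :=
  (P.lawRA.prod P.lawRAC).map (P.aliceView x)

def bobLaw (P : Protocol.{u} X Y Z) (y : Y) : Measure (P.MB × P.RBC) :=
  (P.lawRB.prod P.lawRBC).map (P.bobView y)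

instance (P : Protocol.{u} X Y Z) (x : X) : IsProbabilityMeasure (P.aliceLaw x) :=
  Measure.isProbabilityMeasure_map (P.measurable_aliceView x).aemeasurable

instance (P : Protocol.{u} X Y Z) (y : Y) : IsProbabilityMeasure (P.bobLaw y) :=
  Measure.isProbabilityMeasure_map (P.measurable_bobView y).aemeasurable

/-- The randomness of one run, sorted by player. -/
def sortRand (P : Protocol.{u} X Y Z) (r : P.Rand) :
    ((P.RA × P.RAC) × (P.RB × P.RBC)) × P.RC :=
  (((r.1, r.2.2.2.1), (r.2.1, r.2.2.2.2)), r.2.2.1)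

lemma measurePreserving_sortRand (P : Protocol.{u} X Y Z) :
    MeasurePreserving P.sortRand P.randLaw
      (((P.lawRA.prod P.lawRAC).prod (P.lawRB.prod P.lawRBC)).prod P.lawRC) := by
  have h1 := measurePreserving_prod_left_comm P.lawRC P.lawRAC P.lawRBC
  have h2 := (MeasurePreserving.id P.lawRAC).prod
    (Measure.measurePreserving_swap (μ := P.lawRC) (ν := P.lawRBC))
  have h3 := (MeasurePreserving.id P.lawRB).prod (h2.comp h1)
  have h4 := measurePreserving_prod_left_comm P.lawRB P.lawRAC (P.lawRBC.prod P.lawRC)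
  have h5 := (MeasurePreserving.id P.lawRA).prod (h4.comp h3)
  have h6 := (measurePreserving_prodAssoc P.lawRA P.lawRAC
    (P.lawRB.prod (P.lawRBC.prod P.lawRC))).symm
  have h7 := (MeasurePreserving.id (P.lawRA.prod P.lawRAC)).prod
    (measurePreserving_prodAssoc P.lawRB P.lawRBC P.lawRC).symm
  have h8 := (measurePreserving_prodAssoc (P.lawRA.prod P.lawRAC)
    (P.lawRB.prod P.lawRBC) P.lawRC).symm
  exact h8.comp (h7.comp (h6.comp h5))

/-- The referee's information, sorted by player. -/
def sortView (P : Protocol.{u} X Y Z) (v : P.MA × P.MB × P.RC × P.RAC × P.RBC) :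
    ((P.MA × P.RAC) × (P.MB × P.RBC)) × P.RC :=
  (((v.1, v.2.2.2.1), (v.2.1, v.2.2.2.2)), v.2.2.1)

lemma measurable_sortView (P : Protocol.{u} X Y Z) : Measurable P.sortView := by
  unfold sortView; fun_prop

lemma measurable_refereeView (P : Protocol.{u} X Y Z) :
    Measurable fun ω : (X × Y) × P.Rand => P.refereeView ω.1 ω.2 := by
  refine (P.measurable_alice.comp (f := fun ω : (X × Y) × P.Rand =>
    (ω.1.1, ω.2.1, ω.2.2.2.2.1)) (by fun_prop)).prodMk
    ((P.measurable_bob.comp (f := fun ω : (X × Y) × P.Rand =>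
    (ω.1.2, ω.2.2.1, ω.2.2.2.2.2)) (by fun_prop)).prodMk ?_)
  fun_prop

/-- Alice and Bob share no randomness: for fixed inputs, their views and the referee's private
string depend on disjoint groups of independent coordinates. -/
lemma map_sortView_refereeView (P : Protocol.{u} X Y Z) (w : X × Y) :
    P.randLaw.map (fun r => P.sortView (P.refereeView w r)) =
      ((P.aliceLaw w.1).prod (P.bobLaw w.2)).prod P.lawRC := by
  have hm := ((P.measurable_aliceView w.1).prodMap (P.measurable_bobView w.2)).prodMap
    (measurable_id (α := P.RC))
  have h : (fun r => P.sortView (P.refereeView w r)) =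
      Prod.map (Prod.map (P.aliceView w.1) (P.bobView w.2)) id ∘ P.sortRand := rfl
  rw [h, ← Measure.map_map hm P.measurePreserving_sortRand.measurable,
    P.measurePreserving_sortRand.map_eq, aliceLaw, bobLaw,
    Measure.map_prod_map _ _ (P.measurable_aliceView w.1) (P.measurable_bobView w.2)]
  conv_rhs => rw [← Measure.map_id (μ := P.lawRC)]
  rw [Measure.map_prod_map _ _ ((P.measurable_aliceView w.1).prodMap (P.measurable_bobView w.2))
    measurable_id]

section Bool

variable (P : Protocol.{u} X Y Bool)

/-- The probability over its private randomness that the referee outputs `true`. -/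
def accept (p : (P.MA × P.RAC) × (P.MB × P.RBC)) : ℝ :=
  P.lawRC.real {rC | P.referee (p.1.1, p.2.1, rC, p.1.2, p.2.2) = true}

lemma measurableSet_accept :
    MeasurableSet {q : ((P.MA × P.RAC) × (P.MB × P.RBC)) × P.RC |
      P.referee (q.1.1.1, q.1.2.1, q.2, q.1.1.2, q.1.2.2) = true} :=
  (P.measurable_referee.comp (by fun_prop)) (measurableSet_singleton true)

lemma measurable_accept : Measurable P.accept :=
  (measurable_measure_prodMk_left P.measurableSet_accept).ennreal_toReal

lemma accept_mem_Icc (p : (P.MA × P.RAC) × (P.MB × P.RBC)) : P.accept p ∈ Set.Icc (0 : ℝ) 1 :=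
  ⟨measureReal_nonneg, measureReal_le_one⟩

lemma integral_accept (w : X × Y) :
    ∫ β, ∫ α, P.accept (α, β) ∂P.aliceLaw w.1 ∂P.bobLaw w.2 =
      P.randLaw.real {r | P.output w r = true} := by
  have hi : Integrable P.accept ((P.aliceLaw w.1).prod (P.bobLaw w.2)) :=
    Integrable.of_mem_Icc 0 1 P.measurable_accept.aemeasurable
      (Filter.Eventually.of_forall P.accept_mem_Icc)
  rw [← integral_prod_symm _ hi, integral_eq_lintegral_of_nonneg_ae
    (Filter.Eventually.of_forall fun p => (P.accept_mem_Icc p).1) hi.aestronglyMeasurable,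
    measureReal_def]
  congr 1
  have hv : Measurable fun r => P.sortView (P.refereeView w r) :=
    P.measurable_sortView.comp (P.measurable_refereeView.comp measurable_prodMk_left)
  have h : {r | P.output w r = true} = (fun r => P.sortView (P.refereeView w r)) ⁻¹'
      {q | P.referee (q.1.1.1, q.1.2.1, q.2, q.1.1.2, q.1.2.2) = true} := rfl
  rw [h, ← Measure.map_apply hv P.measurableSet_accept, map_sortView_refereeView,
    Measure.prod_apply P.measurableSet_accept]
  refine lintegral_congr fun p => ?_
  exact ofReal_measureReal

lemma measurableSet_output (w : X × Y) : MeasurableSet {r | P.output w r = true} :=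
  (P.measurable_referee.comp (P.measurable_refereeView.comp measurable_prodMk_left))
    (measurableSet_singleton true)

end Bool

section Uniform

variable {X : Type} [MeasurableSpace X] [Fintype X] [Nonempty X]

/-- For uniform inputs, the information leakage dominates the relative entropy after reduction to
the views of the two players. -/
lemma klDiv_le_leakage (P : Protocol.{u} X X Z) :
    InformationTheory.klDiv
      (mixture fun w : X × X => (Measure.dirac w).prod ((P.aliceLaw w.1).prod (P.bobLaw w.2)))
      ((mixture fun w : X × X => Measure.dirac w).prod
        ((mixture P.aliceLaw).prod (mixture P.bobLaw))) / ENNReal.ofReal (Real.log 2)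
      ≤ P.leakage := by
  set μ : Measure (X × X) := mixture fun w : X × X => Measure.dirac w with hμ
  refine le_trans ?_ (le_iSup₂ (f := fun (μ : Measure (X × X)) (_ : IsProbabilityMeasure μ) =>
    P.leakageOn μ) μ inferInstance)
  unfold leakageOn mutualInfo
  refine ENNReal.div_le_div_right ?_ _
  have hview := P.measurable_refereeView
  have hπ : Measurable fun v => (P.sortView v).1 := P.measurable_sortView.fst
  have hρ : μ.prod P.randLaw =
      mixture fun w : X × X => P.randLaw.map fun r => (w, r) := by
    rw [hμ, mixture_prod]
    simp_rw [Measure.dirac_prod]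
  have hvw : ∀ w, Measurable fun r => P.refereeView w r := fun w =>
    hview.comp measurable_prodMk_left
  have hsw : ∀ w, Measurable fun r => P.sortView (P.refereeView w r) := fun w =>
    P.measurable_sortView.comp (hvw w)
  have hsort : ∀ w : X × X, P.randLaw.map (fun r => (P.sortView (P.refereeView w r)).1) =
      (P.aliceLaw w.1).prod (P.bobLaw w.2) := fun w => by
    have h := congrArg (Measure.map Prod.fst) (P.map_sortView_refereeView w)
    rw [Measure.map_map measurable_fst (hsw w), Measure.map_fst_prod] at h
    simpa [Function.comp_def] using h
  have hfst : (μ.prod P.randLaw).map (fun ω => ω.1) = μ := by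
    rw [Measure.map_fst_prod]; simp
  have hprod : (((μ.prod P.randLaw).map fun ω => ω.1).prod
      ((μ.prod P.randLaw).map fun ω => P.refereeView ω.1 ω.2)).map
        (Prod.map id fun v => (P.sortView v).1) =
      μ.prod ((mixture P.aliceLaw).prod (mixture P.bobLaw)) := by
    rw [← Measure.map_prod_map _ _ measurable_id hπ, Measure.map_id, hfst]
    congr 1
    rw [Measure.map_map hπ hview, hρ, mixture_map _ (hπ.comp hview), mixture_prod_mixture]
    congr 1
    ext1 w
    rw [Measure.map_map (hπ.comp hview) measurable_prodMk_left, ← hsort]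
    rfl
  have hjoint : ((μ.prod P.randLaw).map fun ω => (ω.1, P.refereeView ω.1 ω.2)).map
        (Prod.map id fun v => (P.sortView v).1) =
      mixture fun w : X × X => (Measure.dirac w).prod ((P.aliceLaw w.1).prod (P.bobLaw w.2)) := by
    rw [Measure.map_map (measurable_id.prodMap hπ) (measurable_fst.prodMk hview), hρ,
      mixture_map _ ((measurable_id.prodMap hπ).comp (measurable_fst.prodMk hview))]
    congr 1
    ext1 w
    rw [Measure.map_map ((measurable_id.prodMap hπ).comp (measurable_fst.prodMk hview))
      measurable_prodMk_left, Measure.dirac_prod, ← hsort, Measure.map_map measurable_prodMk_left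
        (hsw w).fst]
    rfl
  rw [← hprod, ← hjoint]
  -- Data processing for the map that sorts the view by player and forgets the referee's private
  -- string.
  exact InformationTheory.klDiv_map_le _ _ (measurable_id.prodMap hπ)

end Uniform

end Protocol

/-! ### Finiteness of the information leakage. -/

section Finite

variable {W : Type*} [Fintype W] [MeasurableSpace W] [DiscreteMeasurableSpace W]

/-- The divergence is the entropy of `μ`, and each term `p * log (1 / p)` is at most `1 - p ≤ 1`.
The crude bound suffices for finiteness. -/
lemma klDiv_diagonal_le (μ : Measure W) [IsProbabilityMeasure μ] :
    InformationTheory.klDiv (μ.map fun w => (w, w)) (μ.prod μ) ≤ Fintype.card W := by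
  classical
  have hd : Measurable fun w : W => (w, w) := Measurable.of_discrete
  have : IsProbabilityMeasure (μ.map fun w => (w, w)) :=
    Measure.isProbabilityMeasure_map hd.aemeasurable
  let r : W × W → ℝ≥0∞ := fun p => if p.1 = p.2 then (μ {p.1})⁻¹ else 0
  have hr : Measurable r := Measurable.of_discrete
  have hden : (μ.map fun w => (w, w)) = (μ.prod μ).withDensity r := by
    refine Measure.ext_of_singleton fun p => ?_
    rw [Measure.map_apply hd (measurableSet_singleton p),
      withDensity_apply _ (measurableSet_singleton p), lintegral_singleton]
    obtain ⟨x, y⟩ := p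
    rw [← Set.singleton_prod_singleton, Measure.prod_prod]
    by_cases h : x = y
    · subst h
      have : (fun w : W => (w, w)) ⁻¹' ({x} ×ˢ {x}) = {x} := by ext; simp
      rw [this]
      by_cases h0 : μ {x} = 0
      · simp [h0]
      · simp only [r, if_true]
        rw [← mul_assoc, ENNReal.inv_mul_cancel h0 (measure_ne_top _ _), one_mul]
    · have : (fun w : W => (w, w)) ⁻¹' ({x} ×ˢ {y}) = ∅ := by
        ext w; simp only [Set.mem_preimage, Set.mem_prod, Set.mem_singleton_iff,
          Set.mem_empty_iff_false, iff_false, not_and]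
        rintro rfl; exact h
      rw [this]
      simp [r, h]
  have hac : (μ.map fun w => (w, w)) ≪ μ.prod μ := by
    rw [hden]; exact withDensity_absolutelyContinuous _ _
  have hint : Integrable (llr (μ.map fun w => (w, w)) (μ.prod μ)) (μ.map fun w => (w, w)) :=
    Integrable.of_finite
  have hllr : llr (μ.map fun w => (w, w)) (μ.prod μ) =ᵐ[μ.map fun w => (w, w)]
      fun p => Real.log (r p).toReal := by
    refine hac.ae_le ?_
    have := Measure.rnDeriv_withDensity (μ.prod μ) hr
    rw [← hden] at this
    filter_upwards [this] with p hp
    rw [llr, hp]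
  rw [InformationTheory.klDiv_of_ac_of_integrable hac hint, integral_congr_ae hllr,
    integral_map hd.aemeasurable (Measurable.of_discrete).aestronglyMeasurable,
    integral_fintype Integrable.of_finite]
  simp only [probReal_univ, add_sub_cancel_right]
  rw [← ENNReal.ofReal_natCast]
  refine ENNReal.ofReal_le_ofReal ?_
  calc ∑ w, μ.real {w} • Real.log (r (w, w)).toReal ≤ ∑ _w : W, (1 : ℝ) := by
        refine Finset.sum_le_sum fun w _ => ?_
        simp only [r, if_true, ENNReal.toReal_inv, smul_eq_mul, ← measureReal_def]
        rcases (measureReal_nonneg (μ := μ) (s := {w})).eq_or_lt with h | h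
        · simp [← h]
        · have h1 := Real.log_le_sub_one_of_pos (inv_pos.mpr h)
          calc μ.real {w} * Real.log (μ.real {w})⁻¹
              ≤ μ.real {w} * ((μ.real {w})⁻¹ - 1) := by gcongr
            _ = 1 - μ.real {w} := by field_simp
            _ ≤ 1 := by linarith
    _ = Fintype.card W := by simp

/-- Data processing: the pair `(U, v U)` is an image of `(U, U)`. -/
lemma mutualInfo_comp_le {Ω V : Type*} [MeasurableSpace Ω] [MeasurableSpace V] (ρ : Measure Ω)
    [IsProbabilityMeasure ρ] {U : Ω → W} (hU : Measurable U) (v : W → V) :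
    mutualInfo ρ U (fun ω => v (U ω)) ≤ Fintype.card W / ENNReal.ofReal (Real.log 2) := by
  have hv : Measurable v := Measurable.of_discrete
  have : IsProbabilityMeasure (ρ.map U) := Measure.isProbabilityMeasure_map hU.aemeasurable
  unfold mutualInfo
  refine ENNReal.div_le_div_right ?_ _
  have h1 : (ρ.map fun ω => (U ω, v (U ω))) =
      ((ρ.map U).map fun w => (w, w)).map (Prod.map id v) := by
    rw [Measure.map_map (measurable_id.prodMap hv) Measurable.of_discrete,
      Measure.map_map Measurable.of_discrete hU]
    rfl
  have h2 : (ρ.map U).prod (ρ.map fun ω => v (U ω)) =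
      ((ρ.map U).prod (ρ.map U)).map (Prod.map id v) := by
    rw [← Measure.map_prod_map _ _ measurable_id hv, Measure.map_id, Measure.map_map hv hU]
    rfl
  rw [h1, h2]
  exact (InformationTheory.klDiv_map_le _ _ (measurable_id.prodMap hv)).trans (klDiv_diagonal_le _)

end Finite

instance {X : Type} [MeasurableSpace X] [DiscreteMeasurableSpace X] :
    DiscreteMeasurableSpace (ULift.{u} X) :=
  ⟨fun s => (MeasurableSet.of_discrete : MeasurableSet (ULift.up ⁻¹' s))⟩

/-- The protocol in which both players send their inputs. -/
def sendInputs {X Z : Type} [Finite X] [MeasurableSpace X] [DiscreteMeasurableSpace X]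
    [MeasurableSpace Z] (f : X × X → Z) : Protocol.{u} X X Z where
  MA := ULift.{u} X
  MB := ULift.{u} X
  RA := PUnit
  RB := PUnit
  RC := PUnit
  RAC := PUnit
  RBC := PUnit
  lawRA := Measure.dirac PUnit.unit
  lawRB := Measure.dirac PUnit.unit
  lawRC := Measure.dirac PUnit.unit
  lawRAC := Measure.dirac PUnit.unit
  lawRBC := Measure.dirac PUnit.unit
  alice p := ⟨p.1⟩
  bob p := ⟨p.1⟩
  referee m := f (m.1.down, m.2.1.down)
  measurable_alice := (Measurable.of_discrete (f := ULift.up)).comp measurable_fst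
  measurable_bob := (Measurable.of_discrete (f := ULift.up)).comp measurable_fst
  measurable_referee := (Measurable.of_discrete (f := fun p : ULift.{u} X × ULift.{u} X =>
    f (p.1.down, p.2.down))).comp (measurable_fst.prodMk (measurable_fst.comp measurable_snd))

lemma IL_ne_top {X Z : Type} [Finite X] [MeasurableSpace X] [DiscreteMeasurableSpace X]
    [MeasurableSpace Z] (f : X × X → Z) {ε : ℝ} (hε : 0 ≤ ε) : IL.{u} f ε ≠ ∞ := by
  have := Fintype.ofFinite X
  have hcomp : (sendInputs.{u} f).Computes f ε := fun w => by
    have : {r | (sendInputs.{u} f).output w r ≠ f w} = ∅ := by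
      rw [Set.eq_empty_iff_forall_notMem]
      exact fun r hr => hr rfl
    rw [Protocol.errorProb, this]
    simpa using hε
  have hle : (sendInputs.{u} f).leakage ≤
      Fintype.card (X × X) / ENNReal.ofReal (Real.log 2) := by
    refine iSup₂_le fun μ hμ => ?_
    -- All random strings are trivial, so the view is a function of the inputs.
    exact mutualInfo_comp_le (μ.prod (sendInputs.{u} f).randLaw) measurable_fst
      fun w => (sendInputs.{u} f).refereeView w
        (PUnit.unit, PUnit.unit, PUnit.unit, PUnit.unit, PUnit.unit)
  refine ne_top_of_le_ne_top ?_ ((iInf₂_le (sendInputs.{u} f) hcomp).trans hle)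
  exact ENNReal.div_ne_top (ENNReal.natCast_ne_top _) (by simp [Real.log_pos])

/-! ### The square root bound and its comparison with the stated one. -/

/-- The optimisation of the number of samples. -/
lemma sq_mul_sqrt_le_of_tradeoff {a b σ m : ℝ} (ha : 0 ≤ a) (hb : 0 ≤ b) (hσ : 0 < σ)
    (hσ2 : σ ≤ 1 / 2) (hm : 0 ≤ m)
    (h : ∀ t : ℕ, 0 < t → 2 * (b + 1) / (σ / 3) + Real.log (64 / (σ / 24)) ≤
      2 * (5 / 8 * σ) ^ 2 * t → 31 / 64 * m ≤ t * a + 1) :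
    σ ^ 2 * √(m / 2) ≤ a + b + 3 := by
  set k := Real.log (64 / (σ / 24)) with hk
  set H := 2 * (b + 1) / (σ / 3) + k with hH
  have hk0 : 0 ≤ k := by
    refine Real.log_nonneg ?_
    rw [le_div_iff₀ (by positivity)]
    linarith
  have hkσ : k * σ ≤ 5 := by
    -- Splitting off `2 ^ 11` leaves a remainder for which `log x ≤ x - 1` is sharp enough.
    have h1 : 64 / (σ / 24) = 2 ^ 11 * (3 / 4 / σ) := by field_simp; norm_num
    have h2 : k = 11 * Real.log 2 + Real.log (3 / 4 / σ) := by
      rw [hk, h1, Real.log_mul (by norm_num) (by positivity), Real.log_pow]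
      norm_num
    have h3 := Real.log_le_sub_one_of_pos (by positivity : 0 < 3 / 4 / σ)
    have h4 := Real.log_two_lt_d9
    have h5 : k ≤ 7.7 + 3 / 4 / σ := by linarith
    calc k * σ ≤ (7.7 + 3 / 4 / σ) * σ := by gcongr
      _ = 7.7 * σ + 3 / 4 := by field_simp
      _ ≤ 5 := by linarith
  have hH0 : 0 < H := by positivity
  have hτ : 0 < 2 * (5 / 8 * σ) ^ 2 := by positivity
  -- The least admissible `t`; rounding up costs at most one extra sample.
  have ht := h ⌈H / (2 * (5 / 8 * σ) ^ 2)⌉₊ (Nat.ceil_pos.mpr (by positivity)) (by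
    rw [← div_le_iff₀' hτ]; exact Nat.le_ceil _)
  have hceil := (Nat.ceil_lt_add_one (by positivity : 0 ≤ H / (2 * (5 / 8 * σ) ^ 2))).le
  have h1 : 31 / 64 * m ≤ (H / (2 * (5 / 8 * σ) ^ 2) + 1) * a + 1 :=
    ht.trans (by gcongr)
  -- The factor `25 / 192 * σ ^ 3` is `2 * (5 / 8 * σ) ^ 2 * (σ / 6)`, chosen to normalise the
  -- coefficient of `a * b` to one.
  have h2 : 25 / 192 * σ ^ 3 * (31 / 64 * m) ≤
      a * (b + (1 + k * σ / 6 + 25 / 192 * σ ^ 3)) + 25 / 192 * σ ^ 3 := by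
    calc _ ≤ 25 / 192 * σ ^ 3 * ((H / (2 * (5 / 8 * σ) ^ 2) + 1) * a + 1) := by gcongr
      _ = _ := by rw [hH]; field_simp; ring
  have hσ3 : σ ^ 3 ≤ 1 / 8 := by
    calc σ ^ 3 ≤ (1 / 2) ^ 3 := by gcongr
      _ = 1 / 8 := by norm_num
  have h3 : a * (b + (1 + k * σ / 6 + 25 / 192 * σ ^ 3)) ≤ a * (b + 2) := by
    gcongr
    linarith
  have h4 : σ ^ 4 * m / 2 ≤ (a + b + 3) ^ 2 := by
    have h5 : σ ^ 4 * m ≤ 1 / 2 * σ ^ 3 * m := by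
      have : σ ^ 4 ≤ 1 / 2 * σ ^ 3 := by
        calc σ ^ 4 = σ * σ ^ 3 := by ring
          _ ≤ _ := by gcongr
      gcongr
    have h6 : 0 ≤ σ ^ 3 * m := by positivity
    -- Here `4 * a * (b + 2) ≤ (a + b + 2) ^ 2`, while `4 * (25 / 192) * (31 / 64)` just exceeds `1
    -- / 4`. Passing from `a + b + 2` to `a + b + 3` absorbs the additive error.
    nlinarith [sq_nonneg (a - (b + 2))]
  calc σ ^ 2 * √(m / 2) = √((σ ^ 2) ^ 2 * (m / 2)) := by
        rw [Real.sqrt_mul (by positivity), Real.sqrt_sq (by positivity)]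
    _ ≤ a + b + 3 := by
        refine Real.sqrt_le_iff.mpr ⟨by positivity, ?_⟩
        linarith [h4, (by ring : (σ ^ 2) ^ 2 * (m / 2) = σ ^ 4 * m / 2)]

namespace Protocol

variable {X : Type} [MeasurableSpace X] [DecidableEq X]

lemma le_integral_accept (P : Protocol.{u} X X Bool) {ε : ℝ}
    (hP : P.Computes (fun w => decide (w.1 = w.2)) ε) (x : X) :
    1 - ε ≤ ∫ β, ∫ α, P.accept (α, β) ∂P.aliceLaw x ∂P.bobLaw x := by
  have h1 := hP (x, x)
  have h2 := P.integral_accept (x, x)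
  have h3 := probReal_compl_eq_one_sub (μ := P.randLaw) (P.measurableSet_output (x, x))
  have h4 : {r | P.output (x, x) r = true}ᶜ =
      {r | P.output (x, x) r ≠ decide ((x, x).1 = (x, x).2)} := by ext r; simp
  rw [h4] at h3
  unfold errorProb at h1
  simp only at h2
  linarith

lemma integral_accept_le (P : Protocol.{u} X X Bool) {ε : ℝ}
    (hP : P.Computes (fun w => decide (w.1 = w.2)) ε) {x y : X} (hxy : x ≠ y) :
    ∫ β, ∫ α, P.accept (α, β) ∂P.aliceLaw x ∂P.bobLaw y ≤ ε := by
  have h1 := hP (x, y)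
  have h2 := P.integral_accept (x, y)
  have h4 : {r | P.output (x, y) r = true} =
      {r | P.output (x, y) r ≠ decide ((x, y).1 = (x, y).2)} := by ext r; simp [hxy]
  rw [h4] at h2
  exact h2.le.trans h1

/-- Square root lower bound on the information leakage of protocols for equality on `X`. -/
theorem ofReal_le_leakage [Fintype X] [Nonempty X] [DiscreteMeasurableSpace X]
    (P : Protocol.{u} X X Bool) {ε : ℝ} (hε : 0 ≤ ε) (hε2 : ε < 1 / 2)
    (hP : P.Computes (fun w => decide (w.1 = w.2)) ε) :
    ENNReal.ofReal (((1 / 2 - ε) ^ 2 * √(Real.log (Fintype.card X) / 2) - 3) / Real.log 2)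
      ≤ P.leakage := by
  obtain ⟨f, hf, hf0, hA, hlf⟩ := exists_mixture_density P.aliceLaw
  obtain ⟨g, hg, hg0, hB, hlg⟩ := exists_mixture_density P.bobLaw
  have hN : (Fintype.card X : ℝ) ≠ 0 := by simp
  set a := (∑ x, ∫ ω, Real.log (f x ω) ∂P.aliceLaw x) / Fintype.card X with ha
  set b := (∑ x, ∫ ω, Real.log (g x ω) ∂P.bobLaw x) / Fintype.card X with hb
  have ha' : ∑ x, ∫ ω, Real.log (f x ω) ∂P.aliceLaw x = Fintype.card X * a := by
    rw [ha]; field_simp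
  have hb' : ∑ x, ∫ ω, Real.log (g x ω) ∂P.bobLaw x = Fintype.card X * b := by
    rw [hb]; field_simp
  have ha0 : 0 ≤ a := div_nonneg (Finset.sum_nonneg fun x _ =>
    log_density_integral_nonneg (hf x) (hA x) (hlf x)) (Nat.cast_nonneg _)
  have hb0 : 0 ≤ b := div_nonneg (Finset.sum_nonneg fun x _ =>
    log_density_integral_nonneg (hg x) (hB x) (hlg x)) (Nat.cast_nonneg _)
  have hbound : (1 / 2 - ε) ^ 2 * √(Real.log (Fintype.card X) / 2) ≤ a + b + 3 := by
    refine sq_mul_sqrt_le_of_tradeoff ha0 hb0 (by linarith) (by linarith)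
      (Real.log_natCast_nonneg _) fun t ht hlt => ?_
    -- The margin `σ = 1/2 - ε` is split as `τ = 5/8 * σ`, `d = σ / 3`, `κ = σ / 24`, which add up
    -- to `σ`.
    exact log_card_le hf hf0 hA hlf hg hB hlg P.measurable_accept P.accept_mem_Icc
      (by linarith) (by linarith) (by linarith) (by ring) (P.le_integral_accept hP)
      (fun x y hxy => P.integral_accept_le hP hxy) ha' hb' hb0 ht hlt
  have hlog2 : 0 < Real.log 2 := Real.log_pos (by norm_num)
  refine le_trans ?_ P.klDiv_le_leakage
  rw [ENNReal.ofReal_div_of_pos hlog2]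
  refine ENNReal.div_le_div_right (le_trans (ENNReal.ofReal_le_ofReal
    (by linarith : _ ≤ a + b)) ?_) _
  exact ofReal_add_le_klDiv hf hf0 hA hlf hg hB hlg ha' hb'

end Protocol

/-- With `τ = 1/2 - ε - δ₁ - δ₂`, the leading term on the left, times `log 2`, is `4 * δ₁ * τ * √(n
* log 2 / 2)`, and `4 * δ₁ * τ ≤ (δ₁ + τ) ^ 2 ≤ (1/2 - ε) ^ 2`. The terms `g₃`, `g₂` and `10` only
lower the left side, and `2 * g₁ ≥ 20` outweighs `3 / log 2`. -/
lemma eq_lower_bound_le {n : ℕ} {ε δ₁ δ₂ : ℝ} (hδ₁ : 0 < δ₁) (hδ₂ : 0 < δ₂)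
    (hsum : ε + δ₁ + δ₂ < 1 / 2) :
    δ₁ * (2 * √(g₃ (ε + δ₁ + δ₂)) * √(n : ℝ) - g₃ (ε + δ₁ + δ₂) - g₂ n n δ₂ - 10)
        - 2 * g₁ (2 * n) ≤
      ((1 / 2 - ε) ^ 2 * √(n * Real.log 2 / 2) - 3) / Real.log 2 := by
  have hlog2 : 0 < Real.log 2 := Real.log_pos (by norm_num)
  have hlog2' := Real.log_two_gt_d9
  have he : log2e = 1 / Real.log 2 := by simp [log2e, Real.logb]
  have he0 : 0 < log2e := by rw [he]; positivity
  set τ := 1 / 2 - (ε + δ₁ + δ₂) with hτ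
  have hτ0 : 0 < τ := by linarith
  have hg3 : g₃ (ε + δ₁ + δ₂) = 2 * τ ^ 2 / Real.log 2 := by
    rw [g₃, he, ← hτ]; ring
  have hg3' : 0 ≤ g₃ (ε + δ₁ + δ₂) := by rw [hg3]; positivity
  have hg2 : 0 ≤ g₂ n n δ₂ := by
    have : 0 ≤ Real.logb 2 (2 * ((n : ℝ) + n) / (δ₂ ^ 2 * log2e) + 1) :=
      Real.logb_nonneg (by norm_num) (by
        have : 0 ≤ 2 * ((n : ℝ) + n) / (δ₂ ^ 2 * log2e) := by positivity
        linarith)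
    unfold g₂
    linarith
  have hg1 : 10 ≤ g₁ (2 * n) := by
    have : 0 ≤ Real.logb 2 (2 * (n : ℝ) + 1) :=
      Real.logb_nonneg (by norm_num) (by linarith [n.cast_nonneg (α := ℝ)])
    unfold g₁
    linarith
  have hsqrt : √(g₃ (ε + δ₁ + δ₂)) * √(n : ℝ) * Real.log 2 = 2 * τ * √(n * Real.log 2 / 2) := by
    rw [← Real.sqrt_mul hg3', hg3]
    have h1 : 2 * τ ^ 2 / Real.log 2 * n = (2 * τ / Real.log 2) ^ 2 * (n * Real.log 2 / 2) := by
      field_simp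
    rw [h1, Real.sqrt_mul (by positivity), Real.sqrt_sq (by positivity)]
    field_simp
  have hmain : 4 * δ₁ * τ * √(n * Real.log 2 / 2) ≤
      (1 / 2 - ε) ^ 2 * √(n * Real.log 2 / 2) := by
    refine mul_le_mul_of_nonneg_right ?_ (Real.sqrt_nonneg _)
    have h1 : 4 * δ₁ * τ ≤ (δ₁ + τ) ^ 2 := by nlinarith [sq_nonneg (δ₁ - τ)]
    refine h1.trans (pow_le_pow_left₀ (by linarith) (by linarith) 2)
  rw [le_div_iff₀ hlog2]
  have hrest : 0 ≤ δ₁ * (g₃ (ε + δ₁ + δ₂) + g₂ n n δ₂ + 10) * Real.log 2 := by positivity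
  have hlast : 3 ≤ 2 * g₁ (2 * n) * Real.log 2 := by nlinarith
  have hexp : δ₁ * (2 * √(g₃ (ε + δ₁ + δ₂)) * √(n : ℝ)) * Real.log 2 =
      4 * δ₁ * τ * √(n * Real.log 2 / 2) := by
    linear_combination (2 * δ₁) * hsqrt
  linarith

end SMP

end

theorem mainTheorem1 (n : ℕ) (ε δ₁ δ₂ : ℝ) (hε : 0 ≤ ε) (hδ₁ : 0 < δ₁) (hδ₂ : 0 < δ₂)
    (hsum : ε + δ₁ + δ₂ < 1 / 2) :
    SMP.IL.{u} (SMP.EQ n) ε ≠ ∞ ∧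
      δ₁ * (2 * √(SMP.g₃ (ε + δ₁ + δ₂)) * √(n : ℝ) - SMP.g₃ (ε + δ₁ + δ₂)
          - SMP.g₂ n n δ₂ - 10) - 2 * SMP.g₁ (2 * n)
        ≤ (SMP.IL.{u} (SMP.EQ n) ε).toReal := by
  have hfin := SMP.IL_ne_top.{u} (SMP.EQ n) hε
  refine ⟨hfin, (SMP.eq_lower_bound_le hδ₁ hδ₂ hsum).trans ?_⟩
  refine (ENNReal.ofReal_le_iff_le_toReal hfin).mp (le_iInf₂ fun P hP => ?_)
  have h := P.ofReal_le_leakage hε (by linarith) hP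
  -- There are `2 ^ n` strings, so `log N = n * log 2`.
  simpa using h
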